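/- Let $d,N\in\mathbb N$ and let $\mathcal H=\ell^2(\mathbb Z^d)\otimes\mathbb C^N$. For a bounded operator $A$ on $\mathcal H$ and $x,y\in\mathbb Z^d$ let $A_{xy}=\langle\delta_x,A\delta_y\rangle$ be the corresponding $N\times N$ matrix block, and let $\|A_{xy}\|$ be its operator norm. $A$ is *local* if for every sufficiently large $\alpha\in\mathbb N$ there is $C_\alpha<\infty$ with $\|A_{xy}\|\le C_\alpha(1+\|x-y\|)^{-\alpha}$ for all $x,y\in\mathbb Z^d$. $A$ is *weakly local* if there is $\nu\in\mathbb N$ such that for every sufficiently large $\mu\in\mathbb N$ there is $C_\mu<\infty$ with $$\|A_{xy}\|\le C_\mu(1+\|x-y\|)^{-\mu}(1+\|x\|)^{\nu}\qquad(x,y\in\mathbb Z^d).$$ A family of operators is weakly local *uniformly* if $\nu$, the threshold for $\mu$, and the constants $C_\mu$ can be chosen the same for all members of the family. Let $\Delta\subseteq\mathbb R$ be an interval, and let $B_1(\Delta)$ be the set of Borel functions $f:\mathbb R\to\mathbb C$ with $\sup_t|f(t)|\le1$ that are constant on $(-\infty,\inf\Delta]$ and constant on $[\sup\Delta,\infty)$.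 A bounded operator $H$ on $\mathcal H$ is a *$\Delta$-insulator* if it is self-adjoint and local, the family $\{f(H):f\in B_1(\Delta)\}$ (Borel functional calculus) is weakly local uniformly, and every eigenvalue of $H$ in $\Delta$ has finite multiplicity. **Claim.** If $H$ is a $\Delta$-insulator, then there is a measurable subset $S\subseteq\Delta$, depending on $H$, of full Lebesgue measure in $\Delta$ (that is, $|\Delta\setminus S|=0$) such that for every $E\in S$ the operator $H-(E+\mathrm i\varepsilon)\mathbb 1$ is invertible for all $\varepsilon\in[-1,1]\setminus\{0\}$, and the family of resolvents $$\bigl(H-(E+\mathrm i\varepsilon)\mathbb 1\bigr)^{-1},\qquad \varepsilon\in[-1,1]\setminus\{0\},$$ is weakly local uniformly in $\varepsilon$. -/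

import Mathlib

open MeasureTheory
open scoped CompactlySupported

set_option linter.unusedSimpArgs false

noncomputable section

section BorelCalculus

variable {E : Type*} [NormedAddCommGroup E] [InnerProductSpace ℂ E] [CompleteSpace E]

/-- The positive linear functional `g ↦ ⟨ψ, g(H) ψ⟩` on real `C_c(ℝ)`, with `g(H)` the continuous
functional calculus of the self-adjoint operator `H`. -/
def spectralFunctional (H : E →L[ℂ] E) (ψ : E) : C_c(ℝ, ℝ) →ₚ[ℝ] ℝ :=
  PositiveLinearMap.mk₀
    { toFun := fun g => (inner ℂ ψ (cfc (g : ℝ → ℝ) H ψ)).re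
      map_add' := by
        intro f g
        have h := cfc_add (a := H) (f : ℝ → ℝ) (g : ℝ → ℝ)
          f.continuous.continuousOn g.continuous.continuousOn
        rw [CompactlySupportedContinuousMap.coe_add, Pi.add_def, h]
        simp [inner_add_right]
      map_smul' := by
        intro c g
        have h := cfc_smul (a := H) c (g : ℝ → ℝ) g.continuous.continuousOn
        rw [CompactlySupportedContinuousMap.coe_smul, Pi.smul_def, h]
        simp [inner_smul_right_eq_smul] }
    (by
      intro g hg
      have h : 0 ≤ cfc (g : ℝ → ℝ) H := cfc_nonneg (fun x _ => hg x)
      rw [ContinuousLinearMap.nonneg_iff_isPositive] at h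
      exact h.re_inner_nonneg_right ψ)

/-- The spectral measure of the self-adjoint operator `H` at the vector `ψ`, that is, the measure
`m` with `⟨ψ, g(H) ψ⟩ = ∫ g dm` for continuous `g`. -/
def spectralMeasureAt (H : E →L[ℂ] E) (ψ : E) : Measure ℝ :=
  RealRMK.rieszMeasure (spectralFunctional H ψ)

lemma spectralMeasureAt_univ_le (H : E →L[ℂ] E) (ψ : E) :
    spectralMeasureAt H ψ Set.univ ≤ ENNReal.ofReal (‖ψ‖ ^ 2) := by
  have : (spectralMeasureAt H ψ).Regular := by unfold spectralMeasureAt; infer_instance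
  rw [isOpen_univ.measure_eq_iSup_isCompact]
  refine iSup₂_le fun K _ => iSup_le fun hK => ?_
  obtain ⟨g, hg1, -, hgc, hg01⟩ :=
    exists_continuous_one_zero_of_isCompact hK isClosed_empty (Set.disjoint_empty K)
  refine (RealRMK.rieszMeasure_le_of_eq_one (spectralFunctional H ψ) (f := ⟨g, hgc⟩)
    (fun x => (hg01 x).1) hK (fun x hx => hg1 hx)).trans (ENNReal.ofReal_le_ofReal ?_)
  have h1 : ‖cfc (g : ℝ → ℝ) H‖ ≤ 1 := norm_cfc_le zero_le_one fun x _ => by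
    rw [Real.norm_of_nonneg (hg01 x).1]; exact (hg01 x).2
  change (inner ℂ ψ (cfc (g : ℝ → ℝ) H ψ)).re ≤ ‖ψ‖ ^ 2
  calc (inner ℂ ψ (cfc (g : ℝ → ℝ) H ψ)).re ≤ ‖inner ℂ ψ (cfc (g : ℝ → ℝ) H ψ)‖ :=
        Complex.re_le_norm _
    _ ≤ ‖ψ‖ * ‖cfc (g : ℝ → ℝ) H ψ‖ := norm_inner_le_norm _ _
    _ ≤ ‖ψ‖ * (1 * ‖ψ‖) := by
        gcongr
        exact (ContinuousLinearMap.le_opNorm _ _).trans (by gcongr)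
    _ = ‖ψ‖ ^ 2 := by ring

instance (H : E →L[ℂ] E) (ψ : E) : IsFiniteMeasure (spectralMeasureAt H ψ) :=
  ⟨(spectralMeasureAt_univ_le H ψ).trans_lt ENNReal.ofReal_lt_top⟩

/-- The quadratic form `ψ ↦ ∫ f dm_ψ`, with `m_ψ` the spectral measure of `H` at `ψ`. -/
def borelQuad (H : E →L[ℂ] E) (f : ℝ → ℂ) (ψ : E) : ℂ := ∫ t, f t ∂(spectralMeasureAt H ψ)

/-- The sesquilinear form obtained from `borelQuad H f` by polarization. -/
def borelForm (H : E →L[ℂ] E) (f : ℝ → ℂ) (φ ψ : E) : ℂ :=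
  (1 / 4 : ℂ) * (borelQuad H f (ψ + φ) - borelQuad H f (ψ - φ)
    + Complex.I * borelQuad H f (ψ + Complex.I • φ)
    - Complex.I * borelQuad H f (ψ - Complex.I • φ))

lemma integral_real_spectralMeasureAt (H : E →L[ℂ] E) (ψ : E) {g : ℝ → ℝ} (hg : Continuous g)
    (hgc : HasCompactSupport g) :
    ((∫ t, g t ∂(spectralMeasureAt H ψ) : ℝ) : ℂ) = inner ℂ ψ (cfc g H ψ) := by
  have h := RealRMK.integral_rieszMeasure (spectralFunctional H ψ) ⟨⟨g, hg⟩, hgc⟩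
  have h2 : ∫ t, g t ∂(spectralMeasureAt H ψ) = (inner ℂ ψ (cfc g H ψ)).re := h
  rw [h2]
  have hs : IsSelfAdjoint (cfc g H) := cfc_predicate g H
  have hsym := hs.isSymmetric
  exact hsym.coe_re_inner_self_apply ψ

lemma integral_spectralMeasureAt (H : E →L[ℂ] E) (ψ : E) {g : ℝ → ℂ} (hg : Continuous g)
    (hgc : HasCompactSupport g) :
    ∫ t, g t ∂(spectralMeasureAt H ψ) = inner ℂ ψ
      ((cfc (fun t => (g t).re) H + Complex.I • cfc (fun t => (g t).im) H : E →L[ℂ] E) ψ) := by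
  have hi : Integrable g (spectralMeasureAt H ψ) := by
    obtain ⟨C, hC⟩ := hgc.exists_bound_of_continuous hg
    exact Integrable.of_bound hg.aestronglyMeasurable C (.of_forall hC)
  have hre := integral_real_spectralMeasureAt H ψ (g := fun t => (g t).re) (by fun_prop)
    (hgc.comp_left (g := Complex.re) rfl)
  have him := integral_real_spectralMeasureAt H ψ (g := fun t => (g t).im) (by fun_prop)
    (hgc.comp_left (g := Complex.im) rfl)
  have := integral_re_add_im (𝕜 := ℂ) hi
  simp only [RCLike.re_to_complex, RCLike.im_to_complex, RCLike.I_to_complex] at this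
  rw [← this]
  simp only [_root_.add_apply, _root_.smul_apply, inner_add_right,
    inner_smul_right]
  rw [← hre, ← him]
  simp [mul_comm]

lemma borelQuad_transfer {H : E →L[ℂ] E} {f : ℝ → ℂ} (hf : Measurable f)
    {C : ℝ} (hC : ∀ t, ‖f t‖ ≤ C) {n : ℕ} (c : Fin n → ℂ) (u : Fin n → E)
    (h : ∀ T : E →L[ℂ] E, ∑ i, c i * inner ℂ (u i) (T (u i)) = 0) :
    ∑ i, c i * borelQuad H f (u i) = 0 := by
  set ρ : Measure ℝ := ∑ i, spectralMeasureAt H (u i) with hρ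
  have hfi : ∀ (m : Measure ℝ) [IsFiniteMeasure m], Integrable f m := fun m _ =>
    Integrable.of_bound hf.aestronglyMeasurable C (.of_forall hC)
  have hle : ∀ i, spectralMeasureAt H (u i) ≤ ρ := fun i =>
    Finset.single_le_sum (f := fun i => spectralMeasureAt H (u i)) (fun _ _ => Measure.zero_le _)
      (Finset.mem_univ i)
  have key : ∀ ε > 0, ‖∑ i, c i * borelQuad H f (u i)‖ ≤ (∑ i, ‖c i‖) * ε := by
    intro ε hε
    obtain ⟨g, hgc, hgε, hg, hgi⟩ := (hfi ρ).exists_hasCompactSupport_integral_sub_le hε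
    have hg0 : ∑ i, c i * borelQuad H g (u i) = 0 := by
      simp only [borelQuad, integral_spectralMeasureAt H _ hg hgc]
      exact h _
    rw [← sub_zero (∑ i, c i * borelQuad H f (u i)), ← hg0, ← Finset.sum_sub_distrib,
      Finset.sum_mul]
    refine norm_sum_le_of_le _ fun i _ => ?_
    rw [← mul_sub, norm_mul]
    gcongr
    have hgi' : Integrable g (spectralMeasureAt H (u i)) := hgi.mono_measure (hle i)
    rw [borelQuad, borelQuad, ← integral_sub (hfi _) hgi']
    refine (norm_integral_le_integral_norm _).trans (le_trans ?_ hgε)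
    exact integral_mono_measure (hle i) (.of_forall fun _ => norm_nonneg _)
      ((hfi ρ).sub hgi).norm
  by_contra hne
  have hpos : 0 < ‖∑ i, c i * borelQuad H f (u i)‖ := norm_pos_iff.mpr hne
  have hS : 0 ≤ ∑ i, ‖c i‖ := Finset.sum_nonneg fun _ _ => norm_nonneg _
  have := key (‖∑ i, c i * borelQuad H f (u i)‖ / (2 * ((∑ i, ‖c i‖) + 1))) (by positivity)
  rw [mul_div_assoc', le_div_iff₀ (by positivity)] at this
  nlinarith

lemma norm_borelQuad_le (H : E →L[ℂ] E) {f : ℝ → ℂ} {C : ℝ} (hC : ∀ t, ‖f t‖ ≤ C) (ψ : E) :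
    ‖borelQuad H f ψ‖ ≤ C * ‖ψ‖ ^ 2 := by
  have hC0 : 0 ≤ C := (norm_nonneg _).trans (hC 0)
  refine (norm_integral_le_of_norm_le_const (.of_forall hC)).trans ?_
  gcongr
  exact ENNReal.toReal_le_of_le_ofReal (by positivity) (spectralMeasureAt_univ_le H ψ)

lemma borelForm_add_right (H : E →L[ℂ] E) {f : ℝ → ℂ} (hf : Measurable f)
    {C : ℝ} (hC : ∀ t, ‖f t‖ ≤ C) (φ ψ χ : E) :
    borelForm H f φ (ψ + χ) = borelForm H f φ ψ + borelForm H f φ χ := by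
  have := borelQuad_transfer (H := H) hf hC
    ![1, -1, Complex.I, -Complex.I, -1, 1, -Complex.I, Complex.I, -1, 1, -Complex.I, Complex.I]
    ![ψ + χ + φ, ψ + χ - φ, ψ + χ + Complex.I • φ, ψ + χ - Complex.I • φ,
      ψ + φ, ψ - φ, ψ + Complex.I • φ, ψ - Complex.I • φ,
      χ + φ, χ - φ, χ + Complex.I • φ, χ - Complex.I • φ] (by
    intro T
    simp [Fin.sum_univ_succ, inner_add_left, inner_add_right, inner_sub_left, inner_sub_right,
      inner_smul_left, inner_smul_right]
    ring)
  simp [Fin.sum_univ_succ] at this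
  unfold borelForm
  linear_combination (1/4 : ℂ) * this

lemma borelForm_add_left (H : E →L[ℂ] E) {f : ℝ → ℂ} (hf : Measurable f)
    {C : ℝ} (hC : ∀ t, ‖f t‖ ≤ C) (φ ψ χ : E) :
    borelForm H f (φ + χ) ψ = borelForm H f φ ψ + borelForm H f χ ψ := by
  have := borelQuad_transfer (H := H) hf hC
    ![1, -1, Complex.I, -Complex.I, -1, 1, -Complex.I, Complex.I, -1, 1, -Complex.I, Complex.I]
    ![ψ + (φ + χ), ψ - (φ + χ), ψ + Complex.I • (φ + χ), ψ - Complex.I • (φ + χ),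
      ψ + φ, ψ - φ, ψ + Complex.I • φ, ψ - Complex.I • φ,
      ψ + χ, ψ - χ, ψ + Complex.I • χ, ψ - Complex.I • χ] (by
    intro T
    simp [Fin.sum_univ_succ, inner_add_left, inner_add_right, inner_sub_left, inner_sub_right,
      inner_smul_left, inner_smul_right]
    ring)
  simp [Fin.sum_univ_succ] at this
  unfold borelForm
  simp only [smul_add]
  linear_combination (1/4 : ℂ) * this

lemma borelForm_smul_right (H : E →L[ℂ] E) {f : ℝ → ℂ} (hf : Measurable f)
    {C : ℝ} (hC : ∀ t, ‖f t‖ ≤ C) (c : ℂ) (φ ψ : E) :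
    borelForm H f φ (c • ψ) = c * borelForm H f φ ψ := by
  have := borelQuad_transfer (H := H) hf hC
    ![1, -1, Complex.I, -Complex.I, -c, c, -c * Complex.I, c * Complex.I]
    ![c • ψ + φ, c • ψ - φ, c • ψ + Complex.I • φ, c • ψ - Complex.I • φ,
      ψ + φ, ψ - φ, ψ + Complex.I • φ, ψ - Complex.I • φ] (by
    intro T
    simp [Fin.sum_univ_succ, inner_add_left, inner_add_right, inner_sub_left, inner_sub_right,
      inner_smul_left, inner_smul_right]
    ring_nf
    simp [Complex.I_sq])
  simp [Fin.sum_univ_succ] at this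
  unfold borelForm
  linear_combination (1/4 : ℂ) * this

lemma borelForm_smul_left (H : E →L[ℂ] E) {f : ℝ → ℂ} (hf : Measurable f)
    {C : ℝ} (hC : ∀ t, ‖f t‖ ≤ C) (c : ℂ) (φ ψ : E) :
    borelForm H f (c • φ) ψ = (starRingEnd ℂ c) * borelForm H f φ ψ := by
  have := borelQuad_transfer (H := H) hf hC
    ![1, -1, Complex.I, -Complex.I, -starRingEnd ℂ c, starRingEnd ℂ c,
      -starRingEnd ℂ c * Complex.I, starRingEnd ℂ c * Complex.I]
    ![ψ + c • φ, ψ - c • φ, ψ + Complex.I • c • φ, ψ - Complex.I • c • φ,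
      ψ + φ, ψ - φ, ψ + Complex.I • φ, ψ - Complex.I • φ] (by
    intro T
    simp [Fin.sum_univ_succ, inner_add_left, inner_add_right, inner_sub_left, inner_sub_right,
      inner_smul_left, inner_smul_right]
    ring_nf
    simp [Complex.I_sq])
  simp [Fin.sum_univ_succ] at this
  unfold borelForm
  linear_combination (1/4 : ℂ) * this

lemma borelForm_self (H : E →L[ℂ] E) {f : ℝ → ℂ} (hf : Measurable f)
    {C : ℝ} (hC : ∀ t, ‖f t‖ ≤ C) (ψ : E) :
    borelForm H f ψ ψ = borelQuad H f ψ := by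
  have := borelQuad_transfer (H := H) hf hC
    ![1, -1, Complex.I, -Complex.I, -4]
    ![ψ + ψ, ψ - ψ, ψ + Complex.I • ψ, ψ - Complex.I • ψ, ψ] (by
    intro T
    simp [Fin.sum_univ_succ, inner_add_left, inner_add_right, inner_sub_left, inner_sub_right,
      inner_smul_left, inner_smul_right]
    ring_nf)
  simp [Fin.sum_univ_succ] at this
  unfold borelForm
  simp
  linear_combination (1/4 : ℂ) * this

lemma norm_borelForm_le (H : E →L[ℂ] E) {f : ℝ → ℂ} (hf : Measurable f)
    {C : ℝ} (hC : ∀ t, ‖f t‖ ≤ C) (φ ψ : E) :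
    ‖borelForm H f φ ψ‖ ≤ 4 * C * ‖φ‖ * ‖ψ‖ := by
  have hC0 : 0 ≤ C := (norm_nonneg _).trans (hC 0)
  have unit : ∀ φ ψ : E, ‖φ‖ ≤ 1 → ‖ψ‖ ≤ 1 → ‖borelForm H f φ ψ‖ ≤ 4 * C := by
    intro φ ψ hφ hψ
    have hq : ∀ χ : E, ‖χ‖ ≤ 2 → ‖borelQuad H f χ‖ ≤ 4 * C := fun χ hχ =>
      (norm_borelQuad_le H hC χ).trans (by nlinarith [norm_nonneg χ, mul_nonneg hC0 (norm_nonneg χ)])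
    have hI : ‖Complex.I • φ‖ ≤ 1 := by simpa [norm_smul] using hφ
    have h1 := hq (ψ + φ) ((norm_add_le _ _).trans (by linarith))
    have h2 := hq (ψ - φ) ((norm_sub_le _ _).trans (by linarith))
    have h3 := hq (ψ + Complex.I • φ) ((norm_add_le _ _).trans (by linarith))
    have h4 := hq (ψ - Complex.I • φ) ((norm_sub_le _ _).trans (by linarith))
    unfold borelForm
    rw [norm_mul]
    have h5 := norm_sub_le (borelQuad H f (ψ + φ) - borelQuad H f (ψ - φ)
      + Complex.I * borelQuad H f (ψ + Complex.I • φ))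
      (Complex.I * borelQuad H f (ψ - Complex.I • φ))
    have h6 := norm_add_le (borelQuad H f (ψ + φ) - borelQuad H f (ψ - φ))
      (Complex.I * borelQuad H f (ψ + Complex.I • φ))
    have h7 := norm_sub_le (borelQuad H f (ψ + φ)) (borelQuad H f (ψ - φ))
    simp only [norm_mul, Complex.norm_I, one_mul] at h5 h6
    norm_num
    linarith
  by_cases hφ : φ = 0
  · have := borelForm_smul_left H hf hC 0 φ ψ
    simp only [hφ, smul_zero, map_zero, zero_mul] at this
    simp [hφ, this]
  by_cases hψ : ψ = 0
  · have := borelForm_smul_right H hf hC 0 φ ψ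
    simp only [hψ, smul_zero, zero_mul] at this
    simp [hψ, this]
  have hφ' : ‖φ‖ ≠ 0 := norm_ne_zero_iff.mpr hφ
  have hψ' : ‖ψ‖ ≠ 0 := norm_ne_zero_iff.mpr hψ
  have e1 : φ = (‖φ‖ : ℂ) • ((‖φ‖⁻¹ : ℝ) : ℂ) • φ := by
    rw [smul_smul]; norm_cast; simp [hφ']
  have e2 : ψ = (‖ψ‖ : ℂ) • ((‖ψ‖⁻¹ : ℝ) : ℂ) • ψ := by
    rw [smul_smul]; norm_cast; simp [hψ']
  have h := unit (((‖φ‖⁻¹ : ℝ) : ℂ) • φ) (((‖ψ‖⁻¹ : ℝ) : ℂ) • ψ)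
    (by simp [norm_smul, hφ']) (by simp [norm_smul, hψ'])
  calc ‖borelForm H f φ ψ‖ = ‖φ‖ * (‖ψ‖ *
        ‖borelForm H f (((‖φ‖⁻¹ : ℝ) : ℂ) • φ) (((‖ψ‖⁻¹ : ℝ) : ℂ) • ψ)‖) := by
        conv_lhs => rw [e1, e2, borelForm_smul_left H hf hC, borelForm_smul_right H hf hC]
        simp
    _ ≤ ‖φ‖ * (‖ψ‖ * (4 * C)) := by gcongr
    _ = 4 * C * ‖φ‖ * ‖ψ‖ := by ring

open Classical in
/-- The operator `f(H)` of the Borel functional calculus of the bounded self-adjoint operator `H`,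
for bounded Borel `f`: the operator `A` with `⟨ψ, A ψ⟩ = ∫ f dm_ψ` for all `ψ` (see
`inner_borelCalculus`; such an `A` is unique). The value is `0` if `f` is not bounded Borel. -/
def borelCalculus (H : E →L[ℂ] E) (f : ℝ → ℂ) : E →L[ℂ] E :=
  if h : Measurable f ∧ ∃ C : ℝ, ∀ t, ‖f t‖ ≤ C then
    ContinuousLinearMap.adjoint (InnerProductSpace.continuousLinearMapOfBilin
      (LinearMap.mkContinuous₂
        (LinearMap.mk₂'ₛₗ (starRingEnd ℂ) (RingHom.id ℂ) (borelForm H f)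
          (fun φ χ ψ => borelForm_add_left H h.1 h.2.choose_spec φ ψ χ)
          (fun c φ ψ => borelForm_smul_left H h.1 h.2.choose_spec c φ ψ)
          (fun φ ψ χ => borelForm_add_right H h.1 h.2.choose_spec φ ψ χ)
          (fun c φ ψ => borelForm_smul_right H h.1 h.2.choose_spec c φ ψ))
        (4 * h.2.choose) (fun φ ψ => norm_borelForm_le H h.1 h.2.choose_spec φ ψ)))
  else 0

lemma inner_borelCalculus (H : E →L[ℂ] E) {f : ℝ → ℂ} (hf : Measurable f)
    {C : ℝ} (hC : ∀ t, ‖f t‖ ≤ C) (ψ : E) :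
    inner ℂ ψ (borelCalculus H f ψ) = ∫ t, f t ∂(spectralMeasureAt H ψ) := by
  have h : Measurable f ∧ ∃ C : ℝ, ∀ t, ‖f t‖ ≤ C := ⟨hf, C, hC⟩
  rw [borelCalculus, dif_pos h, ContinuousLinearMap.adjoint_inner_right,
    InnerProductSpace.continuousLinearMapOfBilin_apply]
  exact borelForm_self H hf hC ψ

end BorelCalculus

section Lattice

/-- The bulk Hilbert space `ℓ²(ℤᵈ) ⊗ ℂᴺ`, realised as `ℓ²(ℤᵈ; ℂᴺ)`. -/
abbrev BulkSpace (d N : ℕ) : Type :=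
  lp (fun _ : Fin d → ℤ => EuclideanSpace ℂ (Fin N)) 2

/-- The Euclidean norm of a lattice point. -/
def latticeNorm {d : ℕ} (x : Fin d → ℤ) : ℝ :=
  ‖(WithLp.toLp 2 (fun i => (x i : ℝ)) : EuclideanSpace ℝ (Fin d))‖

/-- The `N × N` matrix block `A_{xy} = ⟨δ_x, A δ_y⟩`, as an operator on `ℂᴺ`; its norm is the
operator norm. -/
def block {d N : ℕ} (A : BulkSpace d N →L[ℂ] BulkSpace d N) (x y : Fin d → ℤ) :
    EuclideanSpace ℂ (Fin N) →L[ℂ] EuclideanSpace ℂ (Fin N) :=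
  (lp.evalCLM ℂ (fun _ : Fin d → ℤ => EuclideanSpace ℂ (Fin N)) 2 x) ∘L A ∘L
    (lp.singleContinuousLinearMap ℂ (fun _ : Fin d → ℤ => EuclideanSpace ℂ (Fin N)) 2 y)

/-- Local operators. -/
def IsLocal {d N : ℕ} (A : BulkSpace d N →L[ℂ] BulkSpace d N) : Prop :=
  ∃ α₀ : ℕ, ∀ α : ℕ, α₀ ≤ α → ∃ C : ℝ, ∀ x y : Fin d → ℤ,
    ‖block A x y‖ ≤ C * (1 + latticeNorm (x - y)) ^ (-(α : ℤ))

/-- A family of operators is weakly local with estimates uniform in the family: the exponent `ν`,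
the threshold for `μ` and the constants `C = C_μ` do not depend on the member `i`. -/
def UniformlyWeaklyLocal {d N : ℕ} {ι : Type*}
    (A : ι → (BulkSpace d N →L[ℂ] BulkSpace d N)) : Prop :=
  ∃ ν μ₀ : ℕ, ∀ μ : ℕ, μ₀ ≤ μ → ∃ C : ℝ, ∀ (i : ι) (x y : Fin d → ℤ),
    ‖block (A i) x y‖ ≤
      C * (1 + latticeNorm (x - y)) ^ (-(μ : ℤ)) * (1 + latticeNorm x) ^ ν

/-- The class `B₁(Δ)`: Borel functions, bounded by `1`, constant on `(-∞, inf Δ]` and on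
`[sup Δ, ∞)`. These half-lines are the sets of lower and of upper bounds of `Δ` (they are empty
if `Δ` is unbounded on that side). -/
def borelUnitClass (Δ : Set ℝ) : Set (ℝ → ℂ) :=
  {f | Measurable f ∧ (∀ t, ‖f t‖ ≤ 1) ∧
    (∃ c, ∀ t ∈ lowerBounds Δ, f t = c) ∧ (∃ c, ∀ t ∈ upperBounds Δ, f t = c)}

/-- `H` is a `Δ`-insulator: a Hamiltonian (self-adjoint and local) which is mobility-gapped
on `Δ`. -/
structure IsInsulator {d N : ℕ} (H : BulkSpace d N →L[ℂ] BulkSpace d N) (Δ : Set ℝ) : Prop where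
  selfAdjoint : IsSelfAdjoint H
  isLocal : IsLocal H
  weaklyLocal : UniformlyWeaklyLocal (fun f : borelUnitClass Δ => borelCalculus H f)
  finiteMultiplicity : ∀ t ∈ Δ, FiniteDimensional ℂ
    (Module.End.eigenspace (H : BulkSpace d N →ₗ[ℂ] BulkSpace d N) (t : ℂ))

end Lattice

end

/-! The resolvent is split as R(z) = R(z)P_D + R(z)P_Up + R(z)P_Lo, with P the spectral projections
of H on the upper bounds of Δ, on its lower bounds and on the remaining set D. An interior point E
of Δ has positive distance from both half-lines, so these two terms involve only separated spectrum;
the term with P_D is where a null set of energies must be discarded.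

On D, every indicator of a Borel subset of D lies in B₁(Δ). Uniform weak locality therefore bounds
the total variation of each matrix-valued spectral measure on D, with decay in x - y and polynomial
growth in x. Resolvent entries are Cauchy transforms of these measures
(`exists_norm_inner_inverse_le`). After division by a weight their masses are summable over all
pairs (x, y), so one maximal estimate for a summable family, `ae_exists_norm_resolventTransform_le`,
bounds all entries together, for all ε and almost every E.

The maximal estimate avoids singular integrals. For the Cauchy transform F of a positive measure, Im
F ≥ 0 in the upper half-plane, so log|1 - iF| is a nonnegative harmonic function. Its integral over
every horizontal line is at most a constant times the mass of the measure, and it is the Poisson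
integral of its values there. Such an integral is dominated by the centred maximal function, for
which the weak type inequality holds; exponentiating recovers a bound on |F|.

On a half-line, R(z)P is expanded in powers of H - c, where c is chosen so that (H - c)ⁿP grows at a
rate smaller than |z - c|. Locality alone controls the blocks of (H - c)ⁿP only at a possibly larger
rate B. Interpolation between this estimate and the norm estimate brings the rate below |z - c|
while keeping arbitrary polynomial decay (`exists_norm_block_pow_mul_le`), because B does not depend
on the decay exponent (`HasRowMoments.exists_uniform_bound`). -/

/-! ### Poisson formula in a half-plane, transported from the disc. -/

section HalfPlane

open Filter Topology Complex

/-- The Möbius map of the unit disc onto the half-plane `im z > δ` taking `0` to `E + (δ + ε) i`. -/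
noncomputable def halfPlaneMap (E δ ε : ℝ) (w : ℂ) : ℂ :=
  E + δ * I + ε * (I * ((1 + w) / (1 - w)))

lemma halfPlaneMap_im (E δ ε : ℝ) {w : ℂ} (hw : w ≠ 1) :
    (halfPlaneMap E δ ε w).im = δ + ε * ((1 - ‖w‖ ^ 2) / ‖1 - w‖ ^ 2) := by
  have h1 : (1 - w) ≠ 0 := sub_ne_zero.2 hw.symm
  have h2 : Complex.normSq (1 - w) ≠ 0 := by simpa using h1
  have : ((1 + w) / (1 - w)).re = (1 - ‖w‖ ^ 2) / ‖1 - w‖ ^ 2 := by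
    rw [Complex.div_re, ← Complex.normSq_eq_norm_sq, ← Complex.normSq_eq_norm_sq]
    field_simp
    simp [Complex.normSq_apply]
    ring
  simp [halfPlaneMap, ← this]

lemma le_halfPlaneMap_im (E δ : ℝ) {ε : ℝ} (hε : 0 < ε) {w : ℂ} (hw : w ≠ 1) (h : ‖w‖ ≤ 1) :
    δ ≤ (halfPlaneMap E δ ε w).im := by
  rw [halfPlaneMap_im E δ ε hw]
  have : ‖w‖ ^ 2 ≤ 1 := pow_le_one₀ (norm_nonneg _) h
  have : 0 ≤ (1 - ‖w‖ ^ 2) / ‖1 - w‖ ^ 2 := div_nonneg (by linarith) (by positivity)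
  nlinarith

lemma lt_halfPlaneMap_im (E δ : ℝ) {ε : ℝ} (hε : 0 < ε) {w : ℂ} (h : ‖w‖ < 1) :
    δ < (halfPlaneMap E δ ε w).im := by
  have hw : w ≠ 1 := by rintro rfl; simp at h
  rw [halfPlaneMap_im E δ ε hw]
  have h1 : 0 < ‖1 - w‖ := norm_pos_iff.2 (sub_ne_zero.2 hw.symm)
  have : ‖w‖ ^ 2 < 1 := pow_lt_one₀ (norm_nonneg _) h two_ne_zero
  have : 0 < (1 - ‖w‖ ^ 2) / ‖1 - w‖ ^ 2 := div_pos (by linarith) (by positivity)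
  nlinarith [mul_pos hε this]

lemma halfPlaneMap_differentiableAt (E δ ε : ℝ) {w : ℂ} (hw : w ≠ 1) :
    DifferentiableAt ℂ (halfPlaneMap E δ ε) w := by
  have h1 : (1 - w) ≠ 0 := sub_ne_zero.2 hw.symm
  unfold halfPlaneMap
  fun_prop (disch := assumption)

lemma tendsto_halfPlaneMap (E δ : ℝ) {ε : ℝ} (hε : 0 < ε) :
    Tendsto (halfPlaneMap E δ ε) (𝓝[≠] 1) (cocompact ℂ) := by
  rw [← Metric.cobounded_eq_cocompact, ← comap_norm_atTop, tendsto_comap_iff]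
  have h1 : Tendsto (fun w : ℂ => ‖(1 + w) * (1 - w)⁻¹‖) (𝓝[≠] 1) atTop := by
    simp only [norm_mul]
    refine Tendsto.pos_mul_atTop (C := 2) two_pos ?_ ?_
    · have : Tendsto (fun w : ℂ => ‖1 + w‖) (𝓝 1) (𝓝 ‖(1 + 1 : ℂ)‖) :=
        (Continuous.tendsto (by fun_prop) _)
      refine (this.mono_left nhdsWithin_le_nhds).trans ?_
      norm_num
    · have h2 : Tendsto (fun w : ℂ => 1 - w) (𝓝[≠] 1) (𝓝[≠] 0) := by
        refine tendsto_nhdsWithin_iff.2 ⟨?_, ?_⟩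
        · have : Tendsto (fun w : ℂ => 1 - w) (𝓝 1) (𝓝 (1 - 1)) :=
            (Continuous.tendsto (by fun_prop) _)
          rw [sub_self] at this
          exact this.mono_left nhdsWithin_le_nhds
        · filter_upwards [self_mem_nhdsWithin] with w hw
          exact sub_ne_zero.2 (Ne.symm hw)
      exact tendsto_norm_cobounded_atTop.comp ((tendsto_inv₀_nhdsNE_zero (α := ℂ) ).comp h2)
  have h3 : Tendsto (fun w : ℂ => ε * ‖(1 + w) * (1 - w)⁻¹‖ - ‖(E + δ * I : ℂ)‖)
      (𝓝[≠] 1) atTop :=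
    tendsto_atTop_add_const_right _ _ (h1.const_mul_atTop hε)
  refine tendsto_atTop_mono (fun w => ?_) h3
  rw [Function.comp_apply]
  have := norm_sub_le (halfPlaneMap E δ ε w) (E + δ * I : ℂ)
  have e : halfPlaneMap E δ ε w - (E + δ * I : ℂ) = ε * (I * ((1 + w) * (1 - w)⁻¹)) := by
    simp [halfPlaneMap, div_eq_mul_inv]
  rw [e, norm_mul, norm_mul, Complex.norm_I, Complex.norm_real, Real.norm_of_nonneg hε.le] at this
  linarith

/-- With φ = (θ - π)/2 the circle point is -exp(2iφ), and the half-angle formulas turn (1 + w)/(1 -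
w) into -i tan φ. -/
lemma halfPlaneMap_circleMap (E δ ε : ℝ) {θ : ℝ} (h : θ ∈ Set.Ioo 0 (2 * Real.pi)) :
    halfPlaneMap E δ ε (circleMap 0 1 θ) = ((E + ε * Real.tan ((θ - Real.pi) / 2) : ℝ) : ℂ) + δ * I
      ∧ circleMap 0 1 θ ≠ 1 := by
  set φ := (θ - Real.pi) / 2 with hφ
  have hc : 0 < Real.cos φ := Real.cos_pos_of_mem_Ioo ⟨by linarith [h.1], by linarith [h.2]⟩
  have hθ : θ = 2 * φ + Real.pi := by rw [hφ]; ring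
  have hcc : (Complex.cos φ) ≠ 0 := by exact_mod_cast hc.ne'
  have e : circleMap 0 1 θ = - (Complex.cos φ + Complex.sin φ * I) ^ 2 := by
    rw [circleMap, hθ, ← Complex.exp_mul_I, ← Complex.exp_nat_mul]
    push_cast
    rw [add_mul, Complex.exp_add, Complex.exp_pi_mul_I]
    simp; ring_nf
  have hs : Complex.sin φ ^ 2 = 1 - Complex.cos φ ^ 2 := by
    rw [← Complex.sin_sq_add_cos_sq (φ : ℂ)]; ring
  have e2 : 1 - circleMap 0 1 θ = 2 * Complex.cos φ * (Complex.cos φ + Complex.sin φ * I) := by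
    rw [e]; ring_nf; simp [hs]; ring
  have e3 : 1 + circleMap 0 1 θ = - 2 * I * Complex.sin φ * (Complex.cos φ + Complex.sin φ * I) := by
    rw [e]; ring_nf; simp [hs]; ring
  have hne : (Complex.cos φ + Complex.sin φ * I) ≠ 0 := by
    rw [← Complex.exp_mul_I]; exact Complex.exp_ne_zero _
  refine ⟨?_, fun h1 => ?_⟩
  swap
  · rw [h1, sub_self] at e2
    exact mul_ne_zero (mul_ne_zero two_ne_zero hcc) hne e2.symm
  rw [halfPlaneMap, e2, e3]
  rw [mul_div_mul_right _ _ hne]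
  push_cast
  rw [Complex.tan_eq_sin_div_cos]
  field_simp
  simp
  ring

/-- The substitution t = E + ε tan((θ - π)/2) turns the Poisson kernel times dt into dθ/2. -/
lemma lintegral_poissonKernel_mul {g : ℝ → ENNReal} (E : ℝ) {ε : ℝ} (hε : 0 < ε) :
    ∫⁻ t, ENNReal.ofReal (ε / ((t - E) ^ 2 + ε ^ 2)) * g t =
      ENNReal.ofReal (1 / 2) * ∫⁻ θ in Set.Ioo 0 (2 * Real.pi),
        g (E + ε * Real.tan ((θ - Real.pi) / 2)) := by
  have hcos : ∀ θ ∈ Set.Ioo 0 (2 * Real.pi), 0 < Real.cos ((θ - Real.pi) / 2) := fun θ h =>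
    Real.cos_pos_of_mem_Ioo ⟨by linarith [h.1], by linarith [h.2]⟩
  have himg : (fun θ : ℝ => E + ε * Real.tan ((θ - Real.pi) / 2)) '' Set.Ioo 0 (2 * Real.pi)
      = Set.univ := by
    refine Set.eq_univ_of_forall fun t => ⟨2 * Real.arctan ((t - E) / ε) + Real.pi, ?_, ?_⟩
    · constructor
      · linarith [Real.neg_pi_div_two_lt_arctan ((t - E) / ε)]
      · linarith [Real.arctan_lt_pi_div_two ((t - E) / ε)]
    · simp [Real.tan_arctan]
      field_simp
      ring
  have hinj : Set.InjOn (fun θ : ℝ => E + ε * Real.tan ((θ - Real.pi) / 2))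
      (Set.Ioo 0 (2 * Real.pi)) := by
    intro a ha b hb hab
    have : Real.tan ((a - Real.pi) / 2) = Real.tan ((b - Real.pi) / 2) := by
      simpa [hε.ne'] using hab
    have := Real.tan_inj_of_lt_of_lt_pi_div_two (by linarith [ha.1]) (by linarith [ha.2])
      (by linarith [hb.1]) (by linarith [hb.2]) this
    linarith
  have hder : ∀ θ ∈ Set.Ioo 0 (2 * Real.pi), HasDerivWithinAt
      (fun θ : ℝ => E + ε * Real.tan ((θ - Real.pi) / 2))
      (ε * (1 / Real.cos ((θ - Real.pi) / 2) ^ 2 * (1 / 2))) (Set.Ioo 0 (2 * Real.pi)) θ := by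
    intro θ h
    have h1 : HasDerivAt (fun θ : ℝ => (θ - Real.pi) / 2) (1 / 2) θ :=
      ((hasDerivAt_id θ).sub_const _).div_const 2
    exact (((Real.hasDerivAt_tan (hcos θ h).ne').comp θ h1).const_mul ε |>.const_add E).hasDerivWithinAt
  rw [← setLIntegral_univ, ← himg, lintegral_image_eq_lintegral_abs_deriv_mul measurableSet_Ioo hder hinj,
    ← lintegral_const_mul' _ _ ENNReal.ofReal_ne_top]
  refine setLIntegral_congr_fun measurableSet_Ioo fun θ h => ?_
  have hc := hcos θ h
  rw [← mul_assoc, ← ENNReal.ofReal_mul (abs_nonneg _), abs_of_nonneg (by positivity)]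
  congr 2
  rw [Real.tan_eq_sin_div_cos]
  have := Real.sin_sq_add_cos_sq ((θ - Real.pi) / 2)
  field_simp
  linear_combination (-ε ^ 2) * this

/-- The Poisson formula in a half-plane, for the real part of a holomorphic function which
vanishes at infinity. -/
theorem lintegral_poissonKernel_mul_re {G : ℂ → ℂ} {δ : ℝ}
    (hd : DifferentiableOn ℂ G {z | δ < z.im}) (hc : ContinuousOn G {z | δ ≤ z.im})
    (h0 : Tendsto G (cocompact ℂ ⊓ 𝓟 {z | δ ≤ z.im}) (𝓝 0))
    (hpos : ∀ z : ℂ, δ ≤ z.im → 0 ≤ (G z).re) (E : ℝ) {ε : ℝ} (hε : 0 < ε) :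
    ∫⁻ t, ENNReal.ofReal (ε / ((t - E) ^ 2 + ε ^ 2)) * ENNReal.ofReal (G (t + δ * I)).re =
      ENNReal.ofReal (Real.pi * (G (E + (δ + ε : ℝ) * I)).re) := by
  -- The point 1 is the pole of the Möbius map and corresponds to infinity; the value 0 there is the
  -- continuous one because of `h0`.
  set g : ℂ → ℂ := Function.update (fun w => G (halfPlaneMap E δ ε w)) 1 0 with hg
  have hg1 : ∀ w, w ≠ 1 → g w = G (halfPlaneMap E δ ε w) := fun w hw => by simp [hg, hw]
  have hcont : ContinuousOn g (Metric.closedBall 0 1) := by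
    intro w hw
    have hw' : ‖w‖ ≤ 1 := by simpa using hw
    by_cases h : w = 1
    · subst h
      rw [hg, continuousWithinAt_update_same]
      refine h0.comp ?_
      refine tendsto_inf.2 ⟨(tendsto_halfPlaneMap E δ hε).mono_left (nhdsWithin_mono _ fun x hx => hx.2), ?_⟩
      refine tendsto_principal.2 ?_
      filter_upwards [self_mem_nhdsWithin] with x hx
      exact le_halfPlaneMap_im E δ hε hx.2 (by simpa using hx.1)
    · rw [hg, continuousWithinAt_update_of_ne h]
      have h3 : ContinuousWithinAt (fun w => G (halfPlaneMap E δ ε w))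
          (Metric.closedBall 0 1 \ {1}) w := by
        refine (hc _ (le_halfPlaneMap_im E δ hε h hw')).comp
          (halfPlaneMap_differentiableAt E δ ε h).continuousAt.continuousWithinAt ?_
        intro x hx
        exact le_halfPlaneMap_im E δ hε hx.2 (by simpa using hx.1)
      refine h3.mono_of_mem_nhdsWithin ?_
      exact inter_mem_nhdsWithin _ (isOpen_ne.mem_nhds h)
  have hdc : DiffContOnCl ℂ g (Metric.ball 0 |1|) := by
    rw [abs_one]
    refine ⟨?_, by rwa [closure_ball _ one_ne_zero]⟩
    intro w hw
    have hw' : ‖w‖ < 1 := by simpa using hw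
    have h1 : w ≠ 1 := by rintro rfl; simp at hw'
    have h2 : DifferentiableAt ℂ (fun w => G (halfPlaneMap E δ ε w)) w := by
      refine DifferentiableAt.comp w ?_ (halfPlaneMap_differentiableAt E δ ε h1)
      exact (hd _ (lt_halfPlaneMap_im E δ hε hw')).differentiableAt
        ((isOpen_lt continuous_const Complex.continuous_im).mem_nhds (lt_halfPlaneMap_im E δ hε hw'))
    refine (h2.congr_of_eventuallyEq ?_).differentiableWithinAt
    filter_upwards [isOpen_ne.mem_nhds h1] with x hx using hg1 x hx
  -- Mean value property at the centre of the disc, which corresponds to the point at height δ + ε.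
  have hav := hdc.circleAverage
  have hg0 : g 0 = G (E + (δ + ε : ℝ) * I) := by
    rw [hg1 0 zero_ne_one]; simp [halfPlaneMap]; ring_nf
  have hgc : Continuous fun θ => g (circleMap 0 1 θ) :=
    hcont.comp_continuous (continuous_circleMap 0 1) fun θ => by simp
  rw [hg0, Real.circleAverage_def] at hav
  have hre : ∫ θ in (0 : ℝ)..2 * Real.pi, (g (circleMap 0 1 θ)).re =
      2 * Real.pi * (G (E + (δ + ε : ℝ) * I)).re := by
    rw [← hav]
    have := Complex.reCLM.intervalIntegral_comp_comm
      (hgc.intervalIntegrable (μ := volume) 0 (2 * Real.pi))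
    simp only [Complex.reCLM_apply] at this
    rw [this]
    simp
    field_simp
  have hnn : ∀ θ ∈ Set.Ioo 0 (2 * Real.pi), (g (circleMap 0 1 θ)) =
      G (((E + ε * Real.tan ((θ - Real.pi) / 2) : ℝ) : ℂ) + δ * I) := by
    intro θ h
    obtain ⟨h1, h2⟩ := halfPlaneMap_circleMap E δ ε h
    rw [← h1, hg1 _ h2]
  rw [lintegral_poissonKernel_mul E hε (g := fun t => ENNReal.ofReal (G (t + δ * I)).re)]
  rw [intervalIntegral.integral_of_le (by positivity), integral_Ioc_eq_integral_Ioo] at hre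
  have : ∫⁻ θ in Set.Ioo 0 (2 * Real.pi),
        ENNReal.ofReal (G (((E + ε * Real.tan ((θ - Real.pi) / 2) : ℝ) : ℂ) + δ * I)).re =
      ENNReal.ofReal (2 * Real.pi * (G (E + (δ + ε : ℝ) * I)).re) := by
    rw [← hre, ofReal_integral_eq_lintegral_ofReal]
    · refine setLIntegral_congr_fun measurableSet_Ioo fun θ h => ?_
      simp only [hnn θ h]
    · exact ((Complex.continuous_re.comp hgc).integrableOn_Icc).mono_set Set.Ioo_subset_Icc_self
    · refine (ae_restrict_iff' measurableSet_Ioo).2 (.of_forall fun θ h => ?_)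
      simp only [hnn θ h]
      exact hpos _ (by simp [-Complex.ofReal_add, -Complex.ofReal_mul, -Complex.ofReal_tan])
  rw [this, ← ENNReal.ofReal_mul (by norm_num)]
  congr 1
  ring

end HalfPlane

/-! ### The centred maximal function of a measure on the line. -/

section MaximalFunction

open Filter Topology ENNReal

/-- The weak type inequality for the centred Hardy-Littlewood maximal function of a measure on the
line. -/
theorem volume_mul_le_of_exists_closedBall (ν : Measure ℝ) [IsFiniteMeasure ν] {lam : ℝ}
    (hl : 0 < lam) {S : Set ℝ}
    (hS : ∀ E ∈ S, ∃ r > 0, ENNReal.ofReal (lam * r) ≤ ν (Metric.closedBall E r)) :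
    ENNReal.ofReal lam * volume S ≤ 10 * ν Set.univ := by
  choose! r hr0 hr using hS
  have hbd : ∀ a ∈ S, r a ≤ (ν Set.univ).toReal / lam := by
    intro a ha
    rw [le_div_iff₀' hl]
    rw [← ENNReal.ofReal_le_iff_le_toReal (measure_ne_top _ _)]
    exact (hr a ha).trans (measure_mono (Set.subset_univ _))
  -- Vitali covering: intervals of radius 5r have length 10r, which is the source of the constant
  -- 10.
  obtain ⟨u, huS, hdisj, hcov⟩ := Vitali.exists_disjoint_subfamily_covering_enlargement_closedBall
    S (fun a => a) r _ hbd 5 (by norm_num)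
  have hcount : u.Countable := hdisj.countable_of_nonempty_interior fun a ha => by
    rw [Real.closedBall_eq_Icc, interior_Icc, Set.nonempty_Ioo]
    linarith [hr0 a (huS ha)]
  have hsub : S ⊆ ⋃ b ∈ u, Metric.closedBall b (5 * r b) := by
    intro a ha
    obtain ⟨b, hb, hab⟩ := hcov a ha
    exact Set.mem_biUnion hb (hab (Metric.mem_closedBall_self (hr0 a ha).le))
  calc ENNReal.ofReal lam * volume S
      ≤ ENNReal.ofReal lam * ∑' b : u, volume (Metric.closedBall (b : ℝ) (5 * r b)) := by
        gcongr
        exact (measure_mono hsub).trans (measure_biUnion_le _ hcount _)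
    _ = ∑' b : u, 10 * ENNReal.ofReal (lam * r b) := by
        rw [← ENNReal.tsum_mul_left]
        refine tsum_congr fun b => ?_
        rw [Real.volume_closedBall, ← ENNReal.ofReal_mul hl.le,
          show (10 : ℝ≥0∞) = ENNReal.ofReal 10 by simp, ← ENNReal.ofReal_mul (by norm_num)]
        congr 1; ring
    _ ≤ ∑' b : u, 10 * ν (Metric.closedBall (b : ℝ) (r b)) := by
        gcongr with b
        exact hr b (huS b.2)
    _ = 10 * ν (⋃ b ∈ u, Metric.closedBall b (r b)) := by
        rw [ENNReal.tsum_mul_left, measure_biUnion hcount hdisj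
          fun b _ => Metric.isClosed_closedBall.measurableSet]
    _ ≤ 10 * ν Set.univ := by
        gcongr
        exact Set.subset_univ _

/-- The Poisson integral is bounded by the centred maximal function. -/
theorem lintegral_poissonKernel_le (ν : Measure ℝ) {lam E ε : ℝ} (hl : 0 ≤ lam) (hε : 0 < ε)
    (h : ∀ r > 0, ν (Metric.closedBall E r) ≤ ENNReal.ofReal (lam * r)) :
    ∫⁻ t, ENNReal.ofReal (ε / ((t - E) ^ 2 + ε ^ 2)) ∂ν ≤ ENNReal.ofReal (8 * lam) := by
  -- Dyadic domination: if k ≥ 1 is the first index with |t - E| ≤ 2ᵏε, then |t - E| > 2ᵏ⁻¹ε and the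
  -- kernel is at most 4·4⁻ᵏ/ε; for k = 0 the bound 1/ε suffices. Balls of mass at most λ2ᵏε then
  -- contribute 4λ2⁻ᵏ, in total 8λ.
  have hpt : ∀ t, ENNReal.ofReal (ε / ((t - E) ^ 2 + ε ^ 2)) ≤
      ∑' k : ℕ, (Metric.closedBall E (2 ^ k * ε)).indicator
        (fun _ => ENNReal.ofReal (4 * (1 / 4) ^ k / ε)) t := by
    intro t
    have hex : ∃ k : ℕ, |t - E| ≤ 2 ^ k * ε := by
      obtain ⟨k, hk⟩ := pow_unbounded_of_one_lt (|t - E| / ε) (one_lt_two (α := ℝ))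
      exact ⟨k, by rw [div_lt_iff₀ hε] at hk; exact hk.le⟩
    classical
    set k := Nat.find hex with hk
    have hk1 : |t - E| ≤ 2 ^ k * ε := Nat.find_spec hex
    refine le_trans ?_ (ENNReal.le_tsum k)
    rw [Set.indicator_of_mem (by rw [Metric.mem_closedBall, Real.dist_eq]; exact hk1)]
    refine ENNReal.ofReal_le_ofReal ?_
    rw [div_le_div_iff₀ (by positivity) hε]
    rcases Nat.eq_zero_or_pos k with h0 | h0
    · rw [h0]
      nlinarith [sq_nonneg (t - E), sq_nonneg ε]
    · obtain ⟨j, hj⟩ : ∃ j, k = j + 1 := ⟨k - 1, by omega⟩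
      have hk2 : 2 ^ j * ε < |t - E| := not_le.1 (Nat.find_min hex (m := j) (by omega))
      have h3 : (2 ^ j * ε) ^ 2 < (t - E) ^ 2 := by
        rw [← sq_abs (t - E)]; gcongr
      have h4 : (2 ^ j * ε) ^ 2 = 4 ^ j * ε ^ 2 := by
        rw [mul_pow, ← pow_mul, mul_comm j 2, pow_mul]; norm_num
      have h5 : ((1 : ℝ) / 4) ^ j * 4 ^ j = 1 := by rw [← mul_pow]; norm_num
      rw [hj, pow_succ]
      have h6 : 0 < ((1 : ℝ) / 4) ^ j := by positivity
      calc ε * ε = (1 / 4) ^ j * (4 ^ j * ε ^ 2) := by rw [← mul_assoc, h5]; ring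
        _ ≤ (1 / 4) ^ j * ((t - E) ^ 2 + ε ^ 2) := by
          gcongr; rw [← h4]; nlinarith [sq_nonneg ε]
        _ = _ := by ring
  calc ∫⁻ t, ENNReal.ofReal (ε / ((t - E) ^ 2 + ε ^ 2)) ∂ν
      ≤ ∫⁻ t, ∑' k : ℕ, (Metric.closedBall E (2 ^ k * ε)).indicator
        (fun _ => ENNReal.ofReal (4 * (1 / 4) ^ k / ε)) t ∂ν := lintegral_mono hpt
    _ = ∑' k : ℕ, ENNReal.ofReal (4 * (1 / 4) ^ k / ε) * ν (Metric.closedBall E (2 ^ k * ε)) := by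
        rw [lintegral_tsum fun k => (measurable_const.indicator
          Metric.isClosed_closedBall.measurableSet).aemeasurable]
        refine tsum_congr fun k => ?_
        rw [lintegral_indicator_const Metric.isClosed_closedBall.measurableSet]
    _ ≤ ∑' k : ℕ, ENNReal.ofReal (4 * lam * (1 / 2) ^ k) := by
        refine ENNReal.tsum_le_tsum fun k => ?_
        refine (mul_le_mul_right (h (2 ^ k * ε) (by positivity)) _).trans_eq ?_
        rw [← ENNReal.ofReal_mul (by positivity)]
        congr 1
        rw [show ((1 : ℝ) / 4) = 1 / 2 * (1 / 2) by norm_num, mul_pow]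
        have : ((1 : ℝ) / 2) ^ k * 2 ^ k = 1 := by rw [← mul_pow]; norm_num
        generalize ((1 : ℝ) / 2) ^ k = a at *
        generalize (2 : ℝ) ^ k = b at *
        field_simp
        linear_combination a * lam * this
    _ = ENNReal.ofReal (8 * lam) := by
        rw [← ENNReal.ofReal_tsum_of_nonneg (fun k => by positivity)
          (summable_geometric_two.mul_left _), tsum_mul_left, tsum_geometric_two]
        congr 1; ring

end MaximalFunction

/-! ### The Cauchy transform of a positive measure and its logarithm. -/

section CauchyTransform

open Filter Topology Complex

variable (m : Measure ℝ)

lemma resolventTransform_eq_integral_inv (z : ℂ) :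
    resolventTransform m z = ∫ t : ℝ, ((t : ℂ) - z)⁻¹ ∂m := by
  simp [resolventTransform_apply, resolvent]

lemma norm_inv_ofReal_sub_le (t : ℝ) {z : ℂ} (hz : z.im ≠ 0) : ‖((t : ℂ) - z)⁻¹‖ ≤ |z.im|⁻¹ := by
  rw [norm_inv]
  gcongr
  simpa using Complex.abs_im_le_norm ((t : ℂ) - z)

lemma integrable_inv_ofReal_sub [IsFiniteMeasure m] {z : ℂ} (hz : z.im ≠ 0) :
    Integrable (fun t : ℝ => ((t : ℂ) - z)⁻¹) m :=
  Integrable.of_bound (Measurable.aestronglyMeasurable (by fun_prop)) _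
    (.of_forall fun t => norm_inv_ofReal_sub_le t hz)

/-- Reduces bounds in the lower half-plane to the upper one. -/
lemma resolventTransform_conj (z : ℂ) :
    resolventTransform m (starRingEnd ℂ z) = starRingEnd ℂ (resolventTransform m z) := by
  rw [resolventTransform_eq_integral_inv, resolventTransform_eq_integral_inv, ← integral_conj]
  simp

/-- The logarithm of `1 - i F` with `F` the Cauchy transform of a positive measure; its real part is
a positive harmonic function on the upper half-plane. -/
noncomputable def logCauchy (z : ℂ) : ℂ := Complex.log (1 - I * resolventTransform m z)

lemma logCauchy_re (z : ℂ) : (logCauchy m z).re = Real.log ‖1 - I * resolventTransform m z‖ :=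
  Complex.log_re _

variable [IsFiniteMeasure m]

lemma norm_resolventTransform_le {z : ℂ} (hz : z.im ≠ 0) :
    ‖resolventTransform m z‖ ≤ |z.im|⁻¹ * m.real Set.univ := by
  rw [resolventTransform_eq_integral_inv]
  exact norm_integral_le_of_norm_le_const (.of_forall fun t => norm_inv_ofReal_sub_le t hz)

lemma resolventTransform_im_nonneg {z : ℂ} (hz : 0 < z.im) : 0 ≤ (resolventTransform m z).im := by
  rw [resolventTransform_eq_integral_inv]
  have := integral_im (integrable_inv_ofReal_sub m hz.ne')
  simp only [RCLike.im_to_complex] at this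
  rw [← this]
  refine integral_nonneg fun t => ?_
  simp only [Complex.inv_im, Pi.zero_apply]
  refine div_nonneg (by simpa using hz.le) (Complex.normSq_nonneg _)

lemma resolventTransform_differentiableAt {z : ℂ} (hz : z.im ≠ 0) :
    DifferentiableAt ℂ (resolventTransform m) z :=
  (hasDerivAt_resolventTransform z (by rintro ⟨x, -, rfl⟩; simp at hz)).differentiableAt

/-- The bound by mass over height does not decay along horizontal lines, so dominated convergence is
used; staying above height δ supplies the constant majorant δ⁻¹. -/
lemma tendsto_resolventTransform {δ : ℝ} (hδ : 0 < δ) :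
    Tendsto (resolventTransform (A := ℂ) m) (cocompact ℂ ⊓ 𝓟 {z | δ ≤ z.im}) (𝓝 0) := by
  have : (cocompact ℂ).IsCountablyGenerated := by
    rw [← Metric.cobounded_eq_cocompact, ← comap_norm_atTop]; infer_instance
  have h := tendsto_integral_filter_of_dominated_convergence (μ := m)
    (l := cocompact ℂ ⊓ 𝓟 {z : ℂ | δ ≤ z.im}) (F := fun z (t : ℝ) => ((t : ℂ) - z)⁻¹)
    (f := fun _ => 0) (fun _ => δ⁻¹)
    (.of_forall fun z => Measurable.aestronglyMeasurable (by fun_prop))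
    (by
      filter_upwards [mem_inf_of_right (mem_principal_self _)] with z hz
      have hz : δ ≤ z.im := hz
      refine .of_forall fun t => (norm_inv_ofReal_sub_le t (by linarith)).trans ?_
      rw [abs_of_pos (by linarith)]
      gcongr)
    (integrable_const _)
    (.of_forall fun t => by
      refine Tendsto.mono_left ?_ inf_le_left
      rw [← Metric.cobounded_eq_cocompact]
      refine tendsto_inv₀_cobounded.comp ?_
      exact tendsto_const_sub_cobounded _)
  simp only [integral_zero] at h
  exact h.congr fun z => (resolventTransform_eq_integral_inv m z).symm

/-- The real part is 1 + Im F. This keeps 1 - iF in the domain of the principal logarithm and makes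
log|1 - iF| nonnegative. -/
lemma one_le_re_one_sub_resolventTransform {z : ℂ} (hz : 0 < z.im) :
    1 ≤ (1 - I * resolventTransform m z).re := by
  simpa using resolventTransform_im_nonneg m hz

lemma logCauchy_differentiableAt {z : ℂ} (hz : 0 < z.im) :
    DifferentiableAt ℂ (logCauchy m) z := by
  have := one_le_re_one_sub_resolventTransform m hz
  refine DifferentiableAt.clog ?_ (Or.inl (by linarith))
  exact ((resolventTransform_differentiableAt m hz.ne').const_mul I).const_sub 1

lemma logCauchy_re_nonneg {z : ℂ} (hz : 0 < z.im) : 0 ≤ (logCauchy m z).re := by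
  rw [logCauchy_re]
  exact Real.log_nonneg ((one_le_re_one_sub_resolventTransform m hz).trans (Complex.re_le_norm _))

/-- Follows from log x ≤ x - 1 and |1 - iF| ≤ 1 + |F|: passing to the logarithm retains linear
dependence on the mass. -/
lemma logCauchy_re_le {z : ℂ} (hz : 0 < z.im) : (logCauchy m z).re ≤ z.im⁻¹ * m.real Set.univ := by
  rw [logCauchy_re]
  have h1 := (one_le_re_one_sub_resolventTransform m hz).trans (Complex.re_le_norm _)
  have h2 := norm_sub_le (1 : ℂ) (I * resolventTransform m z)
  have h3 := norm_resolventTransform_le m hz.ne'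
  have h4 := Real.log_le_sub_one_of_pos (zero_lt_one.trans_le h1)
  rw [abs_of_pos hz] at h3
  simp only [norm_one, norm_mul, Complex.norm_I, one_mul] at h2
  linarith

lemma norm_resolventTransform_le_exp {z : ℂ} (hz : 0 < z.im) {K : ℝ}
    (h : (logCauchy m z).re ≤ K) : ‖resolventTransform m z‖ ≤ Real.exp K + 1 := by
  rw [logCauchy_re] at h
  have h1 := (one_le_re_one_sub_resolventTransform m hz).trans (Complex.re_le_norm _)
  rw [Real.log_le_iff_le_exp (zero_lt_one.trans_le h1)] at h
  have h2 := norm_sub_norm_le (I * resolventTransform m z) 1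
  rw [norm_sub_rev] at h2
  simp only [norm_one, norm_mul, Complex.norm_I, one_mul] at h2
  linarith

lemma tendsto_logCauchy {δ : ℝ} (hδ : 0 < δ) :
    Tendsto (logCauchy m) (cocompact ℂ ⊓ 𝓟 {z | δ ≤ z.im}) (𝓝 0) := by
  have h1 := ((tendsto_resolventTransform m hδ).const_mul I).const_sub 1
  simp only [mul_zero, sub_zero] at h1
  have h2 := h1.clog (Or.inl (by simp))
  rw [Complex.log_one] at h2
  exact h2

lemma lintegral_poissonKernel_mul_logCauchy {δ : ℝ} (hδ : 0 < δ) (E : ℝ) {ε : ℝ} (hε : 0 < ε) :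
    ∫⁻ t, ENNReal.ofReal (ε / ((t - E) ^ 2 + ε ^ 2)) *
        ENNReal.ofReal (logCauchy m (t + δ * I)).re =
      ENNReal.ofReal (Real.pi * (logCauchy m (E + (δ + ε : ℝ) * I)).re) :=
  lintegral_poissonKernel_mul_re
    (fun _ hz => (logCauchy_differentiableAt m (hδ.trans hz)).differentiableWithinAt)
    (fun _ hz => (logCauchy_differentiableAt m (hδ.trans_le hz)).continuousAt.continuousWithinAt)
    (tendsto_logCauchy m hδ) (fun _ hz => logCauchy_re_nonneg m (hδ.trans_le hz)) E hε

lemma measurable_logCauchy_re : Measurable fun z => (logCauchy m z).re := by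
  have h : StronglyMeasurable (resolventTransform (A := ℂ) m) := by
    have : StronglyMeasurable fun p : ℂ × ℝ => ((p.2 : ℂ) - p.1)⁻¹ :=
      Measurable.stronglyMeasurable (by fun_prop)
    have h2 := this.integral_prod_right' (ν := m)
    convert h2 using 2 with z
    exact resolventTransform_eq_integral_inv m z
  have := h.measurable
  unfold logCauchy
  fun_prop

/-- The mass on a line is read off from a point high above it. On [-R, R] the Poisson kernel of
height R is at least 1/(2R), while the harmonic function at distance R above the line is at most
m(ℝ)/R. The resulting bound depends on neither R nor δ. -/
lemma lintegral_logCauchy_le {δ : ℝ} (hδ : 0 < δ) :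
    ∫⁻ t : ℝ, ENNReal.ofReal (logCauchy m (t + δ * I)).re ≤
      ENNReal.ofReal (2 * Real.pi) * m Set.univ := by
  have hloc : ∀ n : ℕ, ∫⁻ t : ℝ in Set.Icc (-(n + 1 : ℝ)) (n + 1),
      ENNReal.ofReal (logCauchy m (t + δ * I)).re ≤ ENNReal.ofReal (2 * Real.pi) * m Set.univ := by
    intro n
    set R : ℝ := n + 1 with hR
    have hR0 : 0 < R := by positivity
    have hz : 0 < (((0 : ℝ) : ℂ) + (δ + R : ℝ) * I).im := by simp; linarith
    calc ∫⁻ t : ℝ in Set.Icc (-R) R, ENNReal.ofReal (logCauchy m (t + δ * I)).re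
        ≤ ∫⁻ t : ℝ in Set.Icc (-R) R, ENNReal.ofReal (2 * R) *
          (ENNReal.ofReal (R / ((t - 0) ^ 2 + R ^ 2)) *
            ENNReal.ofReal (logCauchy m (t + δ * I)).re) := by
          refine setLIntegral_mono' measurableSet_Icc fun t ht => ?_
          rw [← mul_assoc, ← ENNReal.ofReal_mul (by positivity)]
          refine le_mul_of_one_le_left' ?_
          rw [← ENNReal.ofReal_one]
          refine ENNReal.ofReal_le_ofReal ?_
          rw [mul_div_assoc', one_le_div (by positivity)]
          nlinarith [ht.1, ht.2]
      _ ≤ ∫⁻ t : ℝ, ENNReal.ofReal (2 * R) *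
          (ENNReal.ofReal (R / ((t - 0) ^ 2 + R ^ 2)) *
            ENNReal.ofReal (logCauchy m (t + δ * I)).re) := setLIntegral_le_lintegral _ _
      _ = ENNReal.ofReal (2 * R) * ENNReal.ofReal
            (Real.pi * (logCauchy m ((0 : ℝ) + (δ + R : ℝ) * I)).re) := by
          rw [lintegral_const_mul' _ _ ENNReal.ofReal_ne_top,
            lintegral_poissonKernel_mul_logCauchy m hδ 0 hR0]
      _ ≤ ENNReal.ofReal (2 * R) * ENNReal.ofReal (Real.pi * (R⁻¹ * m.real Set.univ)) := by
          gcongr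
          refine (logCauchy_re_le m hz).trans ?_
          gcongr
          simp; linarith
      _ = ENNReal.ofReal (2 * Real.pi) * m Set.univ := by
          rw [← ENNReal.ofReal_mul (by positivity), ← ofReal_measureReal (μ := m),
            ← ENNReal.ofReal_mul (by positivity)]
          congr 1
          field_simp
  have hU : ⋃ n : ℕ, Set.Icc (-(n + 1 : ℝ)) (n + 1) = Set.univ := by
    refine Set.eq_univ_of_forall fun t => ?_
    obtain ⟨n, hn⟩ := exists_nat_ge |t|
    exact Set.mem_iUnion.2 ⟨n, by constructor <;> linarith [neg_abs_le t, le_abs_self t]⟩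
  rw [← setLIntegral_univ, ← hU, setLIntegral_iUnion_of_directed, hU]
  · exact iSup_le hloc
  · refine Monotone.directed_le fun a b hab => ?_
    have : (a : ℝ) ≤ b := by exact_mod_cast hab
    exact Set.Icc_subset_Icc (by linarith) (by linarith)

end CauchyTransform

/-! ### Maximal estimate for a summable family of Cauchy transforms. -/

section MaximalCauchy

open Filter Topology Complex

variable {ι : Type*} [Countable ι] (m : ι → Measure ℝ) [∀ i, IsFiniteMeasure (m i)]

/-- The boundary densities of all members at height δ add up to one finite measure whose Poisson
integral dominates that of each member, so one application of the weak type inequality handles every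
index at once. -/
lemma volume_setOf_lt_logCauchy_le (hm : ∑' i, m i Set.univ ≠ ⊤) {lam : ℝ} (hl : 0 < lam) :
    ENNReal.ofReal (lam / 4) * volume {E : ℝ | ∃ i, ∃ ε : ℝ, 0 < ε ∧
      lam < (logCauchy (m i) (E + ε * I)).re} ≤
      10 * (ENNReal.ofReal (2 * Real.pi) * ∑' i, m i Set.univ) := by
  -- Heights above 1/(n + 1) are reached by the Poisson formula based at δ = 1/(n + 1). The estimate
  -- is uniform in n, so it passes to the increasing union.
  set B : ℕ → Set ℝ := fun n => {E : ℝ | ∃ i, ∃ ε : ℝ, 1 / (n + 1 : ℝ) < ε ∧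
      lam < (logCauchy (m i) (E + ε * I)).re} with hB
  have hBU : {E : ℝ | ∃ i, ∃ ε : ℝ, 0 < ε ∧ lam < (logCauchy (m i) (E + ε * I)).re} =
      ⋃ n, B n := by
    ext E
    simp only [hB, Set.mem_ofPred_eq, Set.mem_iUnion]
    constructor
    · rintro ⟨i, ε, hε, h⟩
      obtain ⟨n, hn⟩ := exists_nat_one_div_lt hε
      exact ⟨n, i, ε, hn, h⟩
    · rintro ⟨n, i, ε, hε, h⟩
      exact ⟨i, ε, lt_trans (by positivity) hε, h⟩
  have hmono : Monotone B := by
    rintro a b hab E ⟨i, ε, hε, h⟩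
    exact ⟨i, ε, (one_div_le_one_div_of_le (by positivity) (by gcongr)).trans_lt hε, h⟩
  rw [hBU, hmono.measure_iUnion, ENNReal.mul_iSup]
  refine iSup_le fun n => ?_
  set δ : ℝ := 1 / (n + 1 : ℝ) with hδ
  have hδ0 : 0 < δ := by positivity
  have hmeas : ∀ i, Measurable fun t : ℝ => ENNReal.ofReal (logCauchy (m i) (t + δ * I)).re :=
    fun i => ((measurable_logCauchy_re (m i)).comp (by fun_prop :
      Measurable fun t : ℝ => (t + δ * I : ℂ))).ennreal_ofReal
  set ν : Measure ℝ := volume.withDensity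
    fun t => ∑' i, ENNReal.ofReal (logCauchy (m i) (t + δ * I)).re with hν
  have hνu : ν Set.univ ≤ ENNReal.ofReal (2 * Real.pi) * ∑' i, m i Set.univ := by
    rw [hν, withDensity_apply _ MeasurableSet.univ, setLIntegral_univ,
      lintegral_tsum fun i => (hmeas i).aemeasurable, ← ENNReal.tsum_mul_left]
    exact ENNReal.tsum_le_tsum fun i => lintegral_logCauchy_le (m i) hδ0
  have : IsFiniteMeasure ν := ⟨hνu.trans_lt (ENNReal.mul_lt_top ENNReal.ofReal_lt_top hm.lt_top)⟩
  refine (volume_mul_le_of_exists_closedBall ν (by positivity) ?_).trans (by gcongr)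
  rintro E ⟨i, ε, hε, h⟩
  by_contra! hcon
  -- If all balls about E had small mass, π times the value at height ε would be at most 8·λ/4 = 2λ;
  -- but that value exceeds λ, and π > 2.
  have h1 := lintegral_poissonKernel_le ν (lam := lam / 4) (ε := ε - δ) (by positivity)
    (sub_pos.2 hε) fun r hr => (hcon r hr).le
  have h2 : ENNReal.ofReal (Real.pi * (logCauchy (m i) (E + ε * I)).re) ≤
      ENNReal.ofReal (8 * (lam / 4)) := by
    have h3 := lintegral_poissonKernel_mul_logCauchy (m i) hδ0 E (sub_pos.2 hε)
    rw [add_sub_cancel] at h3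
    rw [← h3]
    refine le_trans ?_ h1
    rw [hν, lintegral_withDensity_eq_lintegral_mul _ (Measurable.tsum hmeas) (by fun_prop)]
    refine lintegral_mono fun t => ?_
    rw [Pi.mul_apply, mul_comm]
    gcongr
    exact ENNReal.le_tsum i
  rw [ENNReal.ofReal_le_ofReal_iff (by positivity)] at h2
  nlinarith [Real.pi_gt_three]

/-- The Cauchy transforms of a summable family of positive measures are uniformly bounded along
almost every vertical line. -/
theorem ae_exists_norm_resolventTransform_le (hm : ∑' i, m i Set.univ ≠ ⊤) :
    ∀ᵐ E : ℝ, ∃ K : ℝ, ∀ i, ∀ ε : ℝ, ε ≠ 0 → ‖resolventTransform (m i) (E + I * ε : ℂ)‖ ≤ K := by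
  set C := 10 * (ENNReal.ofReal (2 * Real.pi) * ∑' i, m i Set.univ) with hC
  have hCt : C ≠ ⊤ := ENNReal.mul_ne_top (by simp) (ENNReal.mul_ne_top ENNReal.ofReal_ne_top hm)
  set B : ℕ → Set ℝ := fun n => {E : ℝ | ∃ i, ∃ ε : ℝ, 0 < ε ∧
      (4 * (n + 1) : ℝ) < (logCauchy (m i) (E + ε * I)).re} with hB
  have hBn : ∀ n : ℕ, volume (B n) ≤ C / (n + 1 : ℕ) := by
    intro n
    have h := volume_setOf_lt_logCauchy_le m hm (lam := 4 * (n + 1)) (by positivity)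
    rw [ENNReal.le_div_iff_mul_le (by simp) (by simp), mul_comm]
    convert h using 2
    rw [mul_div_cancel_left₀ _ (by norm_num)]
    rw [← Nat.cast_succ, ENNReal.ofReal_natCast]
  have hlim : Tendsto (fun n : ℕ => C / (n + 1 : ℕ)) atTop (𝓝 0) := by
    have := ENNReal.Tendsto.const_div (a := C) (ENNReal.tendsto_nat_nhds_top) (Or.inr hCt)
    rw [ENNReal.div_top] at this
    exact this.comp (tendsto_add_atTop_nat 1)
  have hnull : volume (⋂ n, B n) = 0 := by
    refine le_antisymm (ge_of_tendsto' hlim fun n => ?_) zero_le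
    exact (measure_mono (Set.iInter_subset _ n)).trans (hBn n)
  filter_upwards [measure_eq_zero_iff_ae_notMem.1 hnull] with E hE
  simp only [Set.mem_iInter, not_forall, hB, Set.mem_ofPred_eq, not_exists, not_and, not_lt] at hE
  obtain ⟨n, hn⟩ := hE
  have hup : ∀ i, ∀ ε : ℝ, 0 < ε →
      ‖resolventTransform (m i) (E + I * ε : ℂ)‖ ≤ Real.exp (4 * (n + 1)) + 1 := by
    intro i ε hε
    rw [mul_comm]
    exact norm_resolventTransform_le_exp (m i) (by simpa using hε) (hn i ε hε)
  refine ⟨Real.exp (4 * (n + 1)) + 1, fun i ε hε => ?_⟩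
  rcases lt_or_gt_of_ne hε with h | h
  · have h1 := hup i (-ε) (by linarith)
    have h2 := resolventTransform_conj (m i) (E + I * ε : ℂ)
    have h3 : starRingEnd ℂ (E + I * ε : ℂ) = E + I * (-ε : ℝ) := by simp
    rw [← h3, h2, RCLike.norm_conj] at h1
    exact h1
  · exact hup i ε h

end MaximalCauchy

/-! ### Algebraic rules for the Borel functional calculus. -/

section BorelCalculusAlgebra

variable {E : Type*} [NormedAddCommGroup E] [InnerProductSpace ℂ E] [CompleteSpace E]

/-- Bounded Borel functions. -/
def IsBoundedBorel (f : ℝ → ℂ) : Prop := Measurable f ∧ ∃ C : ℝ, ∀ t, ‖f t‖ ≤ C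

lemma IsBoundedBorel.integrable {f : ℝ → ℂ} (hf : IsBoundedBorel f) (m : Measure ℝ)
    [IsFiniteMeasure m] : Integrable f m :=
  Integrable.of_bound hf.1.aestronglyMeasurable _ (.of_forall hf.2.choose_spec)

lemma IsBoundedBorel.mul {f g : ℝ → ℂ} (hf : IsBoundedBorel f) (hg : IsBoundedBorel g) :
    IsBoundedBorel fun t => f t * g t := by
  obtain ⟨hf, C, hC⟩ := hf
  obtain ⟨hg, D, hD⟩ := hg
  refine ⟨hf.mul hg, C * D, fun t => ?_⟩
  rw [norm_mul]
  exact mul_le_mul (hC t) (hD t) (norm_nonneg _) ((norm_nonneg _).trans (hC t))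

lemma IsBoundedBorel.add {f g : ℝ → ℂ} (hf : IsBoundedBorel f) (hg : IsBoundedBorel g) :
    IsBoundedBorel fun t => f t + g t := by
  obtain ⟨hf, C, hC⟩ := hf
  obtain ⟨hg, D, hD⟩ := hg
  exact ⟨hf.add hg, C + D, fun t => (norm_add_le _ _).trans (add_le_add (hC t) (hD t))⟩

lemma isBoundedBorel_const (c : ℂ) : IsBoundedBorel fun _ => c :=
  ⟨measurable_const, ‖c‖, fun _ => le_rfl⟩

lemma isBoundedBorel_indicator {s : Set ℝ} (hs : MeasurableSet s) :
    IsBoundedBorel (s.indicator fun _ => 1) :=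
  ⟨measurable_const.indicator hs, 1, fun t => by by_cases h : t ∈ s <;> simp [h]⟩

/-- Continuous functions of compact support are dense in L¹ of the sum of the measures, and the
bounded multipliers `k i` preserve the approximation. Identities known for the continuous calculus
thus extend to Borel functions. -/
lemma sum_integral_eq_zero_of_continuous {n : ℕ} (c : Fin n → ℂ) (k : Fin n → ℝ → ℂ)
    (hk : ∀ i, Continuous (k i)) {K : ℝ} (hK : ∀ i t, ‖k i t‖ ≤ K) (m : Fin n → Measure ℝ)
    [∀ i, IsFiniteMeasure (m i)]
    (h : ∀ g : ℝ → ℂ, Continuous g → HasCompactSupport g → ∑ i, c i * ∫ t, k i t * g t ∂(m i) = 0)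
    {f : ℝ → ℂ} (hf : IsBoundedBorel f) : ∑ i, c i * ∫ t, k i t * f t ∂(m i) = 0 := by
  set ρ : Measure ℝ := ∑ i, m i with hρ
  have hle : ∀ i, m i ≤ ρ := fun i =>
    Finset.single_le_sum (f := m) (fun _ _ => Measure.zero_le _) (Finset.mem_univ i)
  have hkb : ∀ i, IsBoundedBorel (k i) := fun i => ⟨(hk i).measurable, K, hK i⟩
  have key : ∀ ε > 0, ‖∑ i, c i * ∫ t, k i t * f t ∂(m i)‖ ≤ (∑ i, ‖c i‖ * K) * ε := by
    intro ε hε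
    obtain ⟨g, hgc, hgε, hg, hgi⟩ :=
      (hf.integrable ρ).exists_hasCompactSupport_integral_sub_le hε
    rw [← sub_zero (∑ i, c i * ∫ t, k i t * f t ∂(m i)), ← h g hg hgc, ← Finset.sum_sub_distrib,
      Finset.sum_mul]
    refine norm_sum_le_of_le _ fun i _ => ?_
    have hK0 : 0 ≤ K := (norm_nonneg _).trans (hK i 0)
    have hgi' : Integrable g (m i) := hgi.mono_measure (hle i)
    have hgk : Integrable (fun t => k i t * g t) (m i) :=
      hgi'.bdd_mul (hk i).aestronglyMeasurable (.of_forall (hK i))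
    rw [← mul_sub, norm_mul, mul_assoc, ← integral_sub ((hkb i).mul hf |>.integrable _) hgk]
    gcongr
    calc ‖∫ t, k i t * f t - k i t * g t ∂(m i)‖ ≤ ∫ t, K * ‖f t - g t‖ ∂(m i) := by
          refine norm_integral_le_of_norm_le
            ((((hf.integrable _).sub hgi').norm).const_mul K) (.of_forall fun t => ?_)
          rw [← mul_sub, norm_mul]
          exact mul_le_mul_of_nonneg_right (hK i t) (norm_nonneg _)
      _ = K * ∫ t, ‖f t - g t‖ ∂(m i) := integral_const_mul _ _
      _ ≤ K * ε := by
          gcongr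
          refine le_trans ?_ hgε
          exact integral_mono_measure (hle i) (.of_forall fun _ => norm_nonneg _)
            ((hf.integrable ρ).sub hgi).norm
  refine norm_le_zero_iff.1 (le_of_forall_pos_le_add fun ε hε => ?_)
  set S := ∑ i, ‖c i‖ * K
  have h1 := key (ε / (|S| + 1)) (by positivity)
  refine h1.trans ?_
  rw [zero_add, mul_div_assoc', div_le_iff₀ (by positivity)]
  nlinarith [le_abs_self S]

variable (H : E →L[ℂ] E)

lemma inner_borelCalculus_eq_borelForm {f : ℝ → ℂ} (hf : IsBoundedBorel f) (φ ψ : E) :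
    inner ℂ φ (borelCalculus H f ψ) = borelForm H f φ ψ := by
  have h : Measurable f ∧ ∃ C : ℝ, ∀ t, ‖f t‖ ≤ C := hf
  rw [borelCalculus, dif_pos h, ContinuousLinearMap.adjoint_inner_right,
    InnerProductSpace.continuousLinearMapOfBilin_apply]
  rfl

lemma inner_borelCalculus_self {f : ℝ → ℂ} (hf : IsBoundedBorel f) (ψ : E) :
    inner ℂ ψ (borelCalculus H f ψ) = ∫ t, f t ∂(spectralMeasureAt H ψ) :=
  inner_borelCalculus H hf.1 hf.2.choose_spec ψ

omit [CompleteSpace E] in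
lemma ext_of_inner_self {A B : E →L[ℂ] E} (h : ∀ ψ : E, inner ℂ ψ (A ψ) = inner ℂ ψ (B ψ)) :
    A = B := by
  have : (A : E →ₗ[ℂ] E) = B := by
    rw [← ext_inner_map]
    intro x
    have := congrArg (starRingEnd ℂ) (h x)
    simpa [inner_conj_symm] using this
  exact ContinuousLinearMap.coe_injective this

/-- The sesquilinear form is tested at φ = f(H)ψ. The factor 4 comes from the crude polarization
bound and is harmless, since only growth rates of powers matter later. -/
lemma norm_borelCalculus_le {f : ℝ → ℂ} (hf : Measurable f) {C : ℝ} (hC : ∀ t, ‖f t‖ ≤ C) :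
    ‖borelCalculus H f‖ ≤ 4 * C := by
  have hC0 : 0 ≤ C := (norm_nonneg _).trans (hC 0)
  refine ContinuousLinearMap.opNorm_le_bound _ (by positivity) fun ψ => ?_
  set χ := borelCalculus H f ψ with hχ
  have h1 : ‖χ‖ ^ 2 ≤ 4 * C * ‖χ‖ * ‖ψ‖ := by
    have h2 := norm_borelForm_le H hf hC χ ψ
    rw [← inner_borelCalculus_eq_borelForm H ⟨hf, C, hC⟩, ← hχ, inner_self_eq_norm_sq_to_K] at h2
    simpa using h2
  rcases (norm_nonneg χ).eq_or_lt with h | h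
  · rw [← h]; positivity
  · nlinarith

lemma borelCalculus_add {f g : ℝ → ℂ} (hf : IsBoundedBorel f) (hg : IsBoundedBorel g) :
    borelCalculus H (fun t => f t + g t) = borelCalculus H f + borelCalculus H g := by
  refine ext_of_inner_self fun ψ => ?_
  rw [inner_borelCalculus_self H (hf.add hg), _root_.add_apply, inner_add_right,
    inner_borelCalculus_self H hf, inner_borelCalculus_self H hg,
    integral_add (hf.integrable _) (hg.integrable _)]

lemma borelCalculus_const_mul {f : ℝ → ℂ} (c : ℂ) (hf : IsBoundedBorel f) :
    borelCalculus H (fun t => c * f t) = c • borelCalculus H f := by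
  refine ext_of_inner_self fun ψ => ?_
  rw [inner_borelCalculus_self H ((isBoundedBorel_const c).mul hf), _root_.smul_apply,
    inner_smul_right, inner_borelCalculus_self H hf, integral_const_mul]

lemma abs_le_norm_of_mem_spectrum {t : ℝ} (ht : t ∈ spectrum ℝ H) : |t| ≤ ‖H‖ :=
  (spectrum.norm_le_norm_mul_of_mem ht).trans
    (mul_le_of_le_one_right (norm_nonneg _) ContinuousLinearMap.norm_id_le)

/-- A compactly supported cutoff equal to 1 on the ball containing the spectrum already captures the
mass ‖ψ‖². -/
lemma spectralMeasureAt_real_univ (hH : IsSelfAdjoint H) (ψ : E) :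
    (spectralMeasureAt H ψ).real Set.univ = ‖ψ‖ ^ 2 := by
  refine le_antisymm (ENNReal.toReal_le_of_le_ofReal (by positivity)
    (spectralMeasureAt_univ_le H ψ)) ?_
  obtain ⟨g, hg1, -, hgc, hg01⟩ := exists_continuous_one_zero_of_isCompact
    (isCompact_closedBall (0 : ℝ) ‖H‖) isClosed_empty (Set.disjoint_empty _)
  have h := integral_real_spectralMeasureAt H ψ g.continuous hgc
  have h2 : cfc (g : ℝ → ℝ) H = 1 := by
    rw [← cfc_one ℝ H]
    refine cfc_congr fun t ht => ?_
    exact hg1 (mem_closedBall_zero_iff.2 (abs_le_norm_of_mem_spectrum H ht))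
  rw [h2] at h
  simp only [one_apply_eq_self, inner_self_eq_norm_sq_to_K] at h
  have h3 : ∫ t, g t ∂(spectralMeasureAt H ψ) = ‖ψ‖ ^ 2 := Complex.ofReal_injective (by simpa using h)
  rw [← h3]
  have h4 : ∫ t, g t ∂(spectralMeasureAt H ψ) ≤ ∫ _, (1 : ℝ) ∂(spectralMeasureAt H ψ) :=
    integral_mono_of_nonneg (.of_forall fun t => (hg01 t).1) (integrable_const _)
      (.of_forall fun t => (hg01 t).2)
  simpa using h4

lemma borelCalculus_one (hH : IsSelfAdjoint H) : borelCalculus H (fun _ => 1) = 1 := by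
  refine ext_of_inner_self fun ψ => ?_
  rw [inner_borelCalculus_self H (isBoundedBorel_const 1), integral_const,
    spectralMeasureAt_real_univ H hH]
  simp [inner_self_eq_norm_sq_to_K]

/-- The truncation of the identity function to `[-L, L]`. -/
def clip (L t : ℝ) : ℝ := max (-L) (min t L)

lemma continuous_clip (L : ℝ) : Continuous (clip L) := by unfold clip; fun_prop

lemma abs_clip_le {L : ℝ} (hL : 0 ≤ L) (t : ℝ) : |clip L t| ≤ L :=
  abs_le.2 ⟨le_max_left _ _, max_le (by linarith) (min_le_right _ _)⟩

lemma clip_eq_self {L t : ℝ} (h : |t| ≤ L) : clip L t = t := by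
  rw [clip, min_eq_left (abs_le.1 h).2, max_eq_right (abs_le.1 h).1]

lemma clip_mono (L : ℝ) : Monotone (clip L) := fun _ _ h =>
  max_le_max le_rfl (min_le_min h le_rfl)

lemma isBoundedBorel_clip {L : ℝ} (hL : 0 ≤ L) : IsBoundedBorel fun t => (clip L t : ℂ) :=
  ⟨(Complex.continuous_ofReal.comp (continuous_clip L)).measurable, L, fun t => by
    rw [Complex.norm_real]; exact abs_clip_le hL t⟩

variable {H} in
lemma cfc_clip (hH : IsSelfAdjoint H) {L : ℝ} (hL : ‖H‖ ≤ L) : cfc (clip L) H = H := by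
  conv_rhs => rw [← cfc_id ℝ H]
  refine cfc_congr fun t ht => clip_eq_self ?_
  exact (abs_le_norm_of_mem_spectrum H ht).trans hL

-- The only multiplicativity needed is against H, truncated because the calculus accepts bounded
-- functions only. By self-adjointness the right side is the form at (Hψ, ψ). Polarization makes the
-- claim a linear relation between five spectral measures, which holds on continuous functions by
-- `cfc_mul` and extends by density.
variable {H} in
lemma borelCalculus_clip_mul (hH : IsSelfAdjoint H) {L : ℝ} (hL : ‖H‖ ≤ L) {f : ℝ → ℂ}
    (hf : IsBoundedBorel f) :
    borelCalculus H (fun t => clip L t * f t) = H * borelCalculus H f := by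
  have hL0 : 0 ≤ L := (norm_nonneg _).trans hL
  refine ext_of_inner_self fun ψ => ?_
  rw [inner_borelCalculus_self H ((isBoundedBorel_clip hL0).mul hf)]
  change _ = inner ℂ ψ (H (borelCalculus H f ψ))
  have hsym : inner ℂ ψ (H (borelCalculus H f ψ)) = inner ℂ (H ψ) (borelCalculus H f ψ) :=
    (hH.isSymmetric _ _).symm
  rw [hsym, inner_borelCalculus_eq_borelForm H hf]
  have key := sum_integral_eq_zero_of_continuous (n := 5)
    ![4, -1, 1, -Complex.I, Complex.I]
    ![fun t => (clip L t : ℂ), fun _ => 1, fun _ => 1, fun _ => 1, fun _ => 1]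
    (by
      intro i
      fin_cases i
      · exact Complex.continuous_ofReal.comp (continuous_clip L)
      all_goals exact continuous_const) (K := max L 1)
    (by
      intro i t
      fin_cases i
      · exact (by rw [Complex.norm_real]; exact abs_clip_le hL0 t : ‖(clip L t : ℂ)‖ ≤ L).trans
          (le_max_left _ _)
      all_goals simp)
    (fun i => spectralMeasureAt H ((![ψ, ψ + H ψ, ψ - H ψ, ψ + Complex.I • H ψ,
      ψ - Complex.I • H ψ] : Fin 5 → E) i))
    (by
      intro g hg hgc
      have hclip : cfc (fun t => (clip L t * g t : ℂ).re) H =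
          H * cfc (fun t => (g t).re) H := by
        nth_rewrite 2 [← cfc_clip hH hL]
        rw [← cfc_mul (clip L) (fun t => (g t).re) _ (continuous_clip L).continuousOn
          (by fun_prop)]
        simp
      have hclip2 : cfc (fun t => (clip L t * g t : ℂ).im) H =
          H * cfc (fun t => (g t).im) H := by
        nth_rewrite 2 [← cfc_clip hH hL]
        rw [← cfc_mul (clip L) (fun t => (g t).im) _ (continuous_clip L).continuousOn
          (by fun_prop)]
        simp
      set T := (cfc (fun t => (g t).re) H + Complex.I • cfc (fun t => (g t).im) H : E →L[ℂ] E)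
        with hT
      have h1 : ∫ t, (clip L t * g t : ℂ) ∂(spectralMeasureAt H ψ) = inner ℂ (H ψ) (T ψ) := by
        rw [integral_spectralMeasureAt H ψ (g := fun t => (clip L t * g t : ℂ))
          ((Complex.continuous_ofReal.comp (continuous_clip L)).mul hg) hgc.mul_left, hclip, hclip2,
          ← mul_smul_comm, ← mul_add, ← hT]
        exact (hH.isSymmetric _ _).symm
      have h2 := fun χ => integral_spectralMeasureAt H χ hg hgc
      simp only [← hT] at h2
      simp [Fin.sum_univ_succ, h1, h2, inner_add_left, inner_add_right, inner_sub_left,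
        inner_sub_right, inner_smul_left, inner_smul_right]
      ring_nf
      simp [Complex.I_sq]) hf
  simp [Fin.sum_univ_succ] at key
  unfold borelForm borelQuad
  linear_combination (1 / 4 : ℂ) * key

variable {H}

lemma borelCalculus_clip_sub_mul (hH : IsSelfAdjoint H) {L : ℝ} (hL : ‖H‖ ≤ L) (z : ℂ) {f : ℝ → ℂ}
    (hf : IsBoundedBorel f) :
    borelCalculus H (fun t => (clip L t - z) * f t) = (H - z • 1) * borelCalculus H f := by
  have hL0 : 0 ≤ L := (norm_nonneg _).trans hL
  have : (fun t => (clip L t - z) * f t) = fun t => clip L t * f t + (-z) * f t := by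
    ext t; ring
  rw [this, borelCalculus_add H ((isBoundedBorel_clip hL0).mul hf)
    ((isBoundedBorel_const _).mul hf), borelCalculus_clip_mul hH hL hf,
    borelCalculus_const_mul H _ hf, sub_mul, smul_mul_assoc, one_mul, neg_smul, sub_eq_add_neg]

lemma isBoundedBorel_clip_sub {L : ℝ} (hL : 0 ≤ L) (z : ℂ) :
    IsBoundedBorel fun t => clip L t - z := by
  simpa [sub_eq_add_neg] using (isBoundedBorel_clip hL).add (isBoundedBorel_const (-z))

lemma isBoundedBorel_pow {f : ℝ → ℂ} (hf : IsBoundedBorel f) (n : ℕ) :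
    IsBoundedBorel fun t => f t ^ n := by
  induction n with
  | zero => simpa using isBoundedBorel_const 1
  | succ n ih => simpa [pow_succ] using ih.mul hf

lemma borelCalculus_clip_sub_pow_mul (hH : IsSelfAdjoint H) {L : ℝ} (hL : ‖H‖ ≤ L) (z : ℂ)
    {f : ℝ → ℂ} (hf : IsBoundedBorel f) (n : ℕ) :
    borelCalculus H (fun t => (clip L t - z) ^ n * f t) = (H - z • 1) ^ n * borelCalculus H f := by
  have hL0 : 0 ≤ L := (norm_nonneg _).trans hL
  induction n with
  | zero => simp
  | succ n ih =>
    rw [pow_succ', mul_assoc, ← ih, ← borelCalculus_clip_sub_mul hH hL z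
      ((isBoundedBorel_pow (isBoundedBorel_clip_sub hL0 z) n).mul hf)]
    congr 1
    ext t; ring

lemma isUnit_sub_smul_one (hH : IsSelfAdjoint H) {z : ℂ} (hz : z.im ≠ 0) : IsUnit (H - z • 1) := by
  have h : z ∉ spectrum ℂ H := fun h => hz (by
    rw [hH.mem_spectrum_eq_re h]; simp)
  rw [spectrum.notMem_iff, Algebra.algebraMap_eq_smul_one] at h
  simpa using h.neg

lemma isBoundedBorel_inv_clip_sub (L : ℝ) {z : ℂ} (hz : z.im ≠ 0) :
    IsBoundedBorel fun t => ((clip L t : ℂ) - z)⁻¹ := by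
  have := (Complex.continuous_ofReal.comp (continuous_clip L)).measurable
  exact ⟨(Measurable.sub_const this z).inv, _, fun t => norm_inv_ofReal_sub_le _ hz⟩

/-- The resolvent multiplied by `f(H)` is given by the Borel functional calculus. -/
lemma inverse_mul_borelCalculus (hH : IsSelfAdjoint H) {L : ℝ} (hL : ‖H‖ ≤ L) {z : ℂ}
    (hz : z.im ≠ 0) {f : ℝ → ℂ} (hf : IsBoundedBorel f) :
    Ring.inverse (H - z • 1) * borelCalculus H f =
      borelCalculus H (fun t => ((clip L t : ℂ) - z)⁻¹ * f t) := by
  have h := borelCalculus_clip_sub_mul hH hL z ((isBoundedBorel_inv_clip_sub L hz).mul hf)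
  have h2 : (fun t => ((clip L t : ℂ) - z) * (((clip L t : ℂ) - z)⁻¹ * f t)) = f := by
    ext t
    rw [mul_inv_cancel_left₀]
    intro h0
    apply hz
    have := congrArg Complex.im h0
    simpa using this
  rw [h2] at h
  rw [h, ← mul_assoc, Ring.inverse_mul_cancel _ (isUnit_sub_smul_one hH hz), one_mul]

end BorelCalculusAlgebra

/-! ### Weights and sums on the lattice. -/

section LatticeNorm

variable {d : ℕ}

lemma latticeNorm_nonneg (x : Fin d → ℤ) : 0 ≤ latticeNorm x := norm_nonneg _

lemma latticeNorm_zero : latticeNorm (0 : Fin d → ℤ) = 0 := by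
  unfold latticeNorm
  rw [norm_eq_zero]
  ext i
  simp

lemma latticeNorm_add_le (x y : Fin d → ℤ) :
    latticeNorm (x + y) ≤ latticeNorm x + latticeNorm y := by
  unfold latticeNorm
  refine (le_of_eq ?_).trans (norm_add_le _ _)
  congr 1
  ext i
  simp

lemma latticeNorm_sub_comm (x y : Fin d → ℤ) : latticeNorm (x - y) = latticeNorm (y - x) := by
  unfold latticeNorm
  rw [← norm_neg]
  congr 1
  ext i
  simp

lemma abs_le_latticeNorm (x : Fin d → ℤ) (i : Fin d) : |(x i : ℝ)| ≤ latticeNorm x := by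
  exact PiLp.norm_apply_le (WithLp.toLp 2 (fun i => (x i : ℝ)) : EuclideanSpace ℝ (Fin d)) i

lemma summable_inv_one_add_abs_sq : Summable fun n : ℤ => ((1 + |(n : ℝ)|) ^ 2)⁻¹ := by
  have h := (summable_nat_add_iff 1).2 (Real.summable_nat_pow_inv.2 one_lt_two)
  have h' : Summable fun n : ℕ => ((1 + |((n : ℤ) : ℝ)|) ^ 2)⁻¹ :=
    h.congr fun n => by
      push_cast
      rw [abs_of_nonneg n.cast_nonneg, add_comm]
  refine summable_int_iff_summable_nat_and_neg.2 ⟨h', h'.congr fun n => ?_⟩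
  push_cast
  rw [abs_neg]

/-- A finite set of lattice points lies in a box, over which the sum of products factors. -/
lemma summable_prod_pi {g : ℤ → ℝ} (h0 : ∀ n, 0 ≤ g n) (hg : Summable g) :
    Summable fun x : Fin d → ℤ => ∏ i, g (x i) := by
  classical
  refine summable_of_sum_le (c := (∑' n, g n) ^ d)
    (fun x => Finset.prod_nonneg fun i _ => h0 _) fun s => ?_
  calc ∑ x ∈ s, ∏ i, g (x i)
      ≤ ∑ x ∈ Fintype.piFinset fun i => s.image fun x => x i, ∏ i, g (x i) := by
        refine Finset.sum_le_sum_of_subset_of_nonneg (fun x hx => ?_)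
          fun _ _ _ => Finset.prod_nonneg fun i _ => h0 _
        exact Fintype.mem_piFinset.2 fun i => Finset.mem_image_of_mem _ hx
    _ = ∏ i : Fin d, ∑ n ∈ s.image fun x => x i, g n := (Finset.prod_univ_sum _ _).symm
    _ ≤ ∏ _i : Fin d, ∑' n, g n :=
        Finset.prod_le_prod (fun _ _ => Finset.sum_nonneg fun _ _ => h0 _)
          fun i _ => hg.sum_le_tsum _ fun _ _ => h0 _
    _ = _ := by simp

/-- The lattice sum of `(1 + ‖x‖)⁻ᵖ` converges for `p = 2 d`. -/
lemma summable_inv_one_add_latticeNorm :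
    Summable fun x : Fin d → ℤ => ((1 + latticeNorm x) ^ (2 * d))⁻¹ := by
  have h2 := summable_prod_pi (d := d) (g := fun n : ℤ => ((1 + |(n : ℝ)|) ^ 2)⁻¹)
    (fun _ => by positivity) summable_inv_one_add_abs_sq
  refine Summable.of_nonneg_of_le (fun x => ?_) (fun x => ?_) h2
  · have := latticeNorm_nonneg x; positivity
  · rw [Finset.prod_inv_distrib]
    gcongr
    calc ∏ i, (1 + |(x i : ℝ)|) ^ 2 ≤ ∏ _i : Fin d, (1 + latticeNorm x) ^ 2 := by
          gcongr with i
          exact abs_le_latticeNorm x i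
      _ = _ := by simp [← pow_mul]

/-- Submultiplicativity of the weight `1 + θ ‖x‖`. -/
lemma one_add_latticeNorm_le {θ : ℝ} (hθ : 0 ≤ θ) (x y w : Fin d → ℤ) :
    1 + θ * latticeNorm (x - y) ≤
      (1 + θ * latticeNorm (x - w)) * (1 + θ * latticeNorm (w - y)) := by
  have h := latticeNorm_add_le (x - w) (w - y)
  rw [sub_add_sub_cancel] at h
  have := latticeNorm_nonneg (x - w)
  have := latticeNorm_nonneg (w - y)
  nlinarith [mul_nonneg (mul_nonneg hθ ‹0 ≤ latticeNorm (x - w)›)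
    (mul_nonneg hθ ‹0 ≤ latticeNorm (w - y)›)]

end LatticeNorm

/-! ### Block estimates for products and powers. -/

section Blocks

variable {d N : ℕ}

lemma block_apply (A : BulkSpace d N →L[ℂ] BulkSpace d N) (x y : Fin d → ℤ)
    (v : EuclideanSpace ℂ (Fin N)) :
    block A x y v = A (lp.single 2 y v) x := rfl

lemma block_add (A B : BulkSpace d N →L[ℂ] BulkSpace d N) (x y : Fin d → ℤ) :
    block (A + B) x y = block A x y + block B x y := by
  ext v; simp [block_apply]

lemma block_sub (A B : BulkSpace d N →L[ℂ] BulkSpace d N) (x y : Fin d → ℤ) :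
    block (A - B) x y = block A x y - block B x y := by
  ext v; simp [block_apply]

lemma block_smul (c : ℂ) (A : BulkSpace d N →L[ℂ] BulkSpace d N) (x y : Fin d → ℤ) :
    block (c • A) x y = c • block A x y := by
  ext v; simp [block_apply]

lemma block_sum {κ : Type*} (s : Finset κ) (A : κ → (BulkSpace d N →L[ℂ] BulkSpace d N))
    (x y : Fin d → ℤ) : block (∑ i ∈ s, A i) x y = ∑ i ∈ s, block (A i) x y := by
  classical
  induction s using Finset.induction_on with
  | empty => ext v; simp [block_apply]
  | insert a s ha ih => rw [Finset.sum_insert ha, Finset.sum_insert ha, block_add, ih]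

lemma norm_block_le (A : BulkSpace d N →L[ℂ] BulkSpace d N) (x y : Fin d → ℤ) :
    ‖block A x y‖ ≤ ‖A‖ := by
  refine ContinuousLinearMap.opNorm_le_bound _ (norm_nonneg _) fun v => ?_
  rw [block_apply]
  refine (lp.norm_apply_le_norm two_ne_zero _ x).trans ((A.le_opNorm _).trans ?_)
  rw [lp.norm_single (by norm_num)]

lemma norm_block_one_le (x y : Fin d → ℤ) :
    ‖block (1 : BulkSpace d N →L[ℂ] BulkSpace d N) x y‖ ≤ if y = x then 1 else 0 := by
  split_ifs with h
  · exact (norm_block_le _ _ _).trans ContinuousLinearMap.norm_id_le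
  · refine le_of_eq (norm_eq_zero.2 ?_)
    ext v i
    simp [block_apply, lp.single_apply, Pi.single_apply, Ne.symm h]

/-- The vector T(δ_y ⊗ v) is the norm-convergent sum of its single-site parts, to which the
continuous map A applies term by term. The majorant τ lets inductive bounds be inserted directly. -/
lemma norm_block_mul_le (A T : BulkSpace d N →L[ℂ] BulkSpace d N) (x y : Fin d → ℤ)
    {τ : (Fin d → ℤ) → ℝ} (hτ : ∀ w, ‖block T w y‖ ≤ τ w)
    (hs : Summable fun w => ‖block A x w‖ * τ w) :
    ‖block (A * T) x y‖ ≤ ∑' w, ‖block A x w‖ * τ w := by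
  have h0 : ∀ w, 0 ≤ ‖block A x w‖ * τ w := fun w =>
    mul_nonneg (norm_nonneg _) ((norm_nonneg _).trans (hτ w))
  refine ContinuousLinearMap.opNorm_le_bound _ (tsum_nonneg h0) fun v => ?_
  set f := T (lp.single 2 y v) with hf
  have h1 := lp.hasSum_single (p := 2) (by norm_num) f
  have h2 : HasSum (fun w => block A x w (f w)) (block (A * T) x y v) :=
    h1.mapL ((lp.evalCLM ℂ (fun _ : Fin d → ℤ => EuclideanSpace ℂ (Fin N)) 2 x) ∘L A)
  refine h2.norm_le_of_bounded (hs.hasSum.mul_right ‖v‖) fun w => ?_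
  rw [mul_assoc]
  refine (ContinuousLinearMap.le_opNorm _ _).trans ?_
  gcongr
  exact ((block T w y).le_opNorm v).trans (by gcongr; exact hτ w)

/-- Uniform summability of the block norms of all rows, with all polynomial weights. -/
def HasRowMoments (A : BulkSpace d N →L[ℂ] BulkSpace d N) : Prop :=
  ∀ β : ℕ, ∃ W : ℝ, ∀ x, Summable (fun w => ‖block A x w‖ * (1 + latticeNorm (x - w)) ^ β) ∧
    ∑' w, ‖block A x w‖ * (1 + latticeNorm (x - w)) ^ β ≤ W

/-- Decay of order β + 2d pays for the weight and leaves the summable power 2d; adding α₀ keeps the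
exponent above the locality threshold. -/
lemma IsLocal.hasRowMoments {A : BulkSpace d N →L[ℂ] BulkSpace d N} (hA : IsLocal A) :
    HasRowMoments A := by
  intro β
  obtain ⟨α₀, h⟩ := hA
  obtain ⟨C, hC⟩ := h (α₀ + (β + 2 * d)) (by omega)
  have hsum : ∀ x : Fin d → ℤ, HasSum (fun w => |C| * ((1 + latticeNorm (x - w)) ^ (2 * d))⁻¹)
      (|C| * ∑' w : Fin d → ℤ, ((1 + latticeNorm w) ^ (2 * d))⁻¹) := by
    intro x
    have := (Equiv.subLeft x).hasSum_iff.2 (summable_inv_one_add_latticeNorm (d := d)).hasSum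
    exact this.mul_left _
  have hle : ∀ x w : Fin d → ℤ, ‖block A x w‖ * (1 + latticeNorm (x - w)) ^ β ≤
      |C| * ((1 + latticeNorm (x - w)) ^ (2 * d))⁻¹ := by
    intro x w
    have h1 := hC x w
    set D := 1 + latticeNorm (x - w) with hD
    have hD1 : 1 ≤ D := by linarith [latticeNorm_nonneg (x - w)]
    have hD0 : 0 < D := by linarith
    rw [zpow_neg, zpow_natCast] at h1
    calc ‖block A x w‖ * D ^ β ≤ (|C| * (D ^ (β + 2 * d))⁻¹) * D ^ β := by
          gcongr
          refine h1.trans (mul_le_mul (le_abs_self C) ?_ (by positivity) (abs_nonneg C))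
          exact inv_anti₀ (by positivity) (pow_le_pow_right₀ hD1 (by omega))
      _ = |C| * (D ^ (2 * d))⁻¹ := by rw [pow_add]; field_simp
  refine ⟨|C| * ∑' w : Fin d → ℤ, ((1 + latticeNorm w) ^ (2 * d))⁻¹, fun x => ?_⟩
  have hs := Summable.of_nonneg_of_le (fun w => mul_nonneg (norm_nonneg _)
    (pow_nonneg (by linarith [latticeNorm_nonneg (x - w)]) β)) (hle x) (hsum x).summable
  exact ⟨hs, (hs.tsum_le_tsum (hle x) (hsum x).summable).trans_eq (hsum x).tsum_eq⟩

lemma HasRowMoments.sub_smul_one {A : BulkSpace d N →L[ℂ] BulkSpace d N} (hA : HasRowMoments A)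
    (c : ℂ) : HasRowMoments (A - c • 1) := by
  intro β
  obtain ⟨W, hW⟩ := hA β
  refine ⟨W + ‖c‖, fun x => ?_⟩
  have hle : ∀ w, ‖block (A - c • 1) x w‖ * (1 + latticeNorm (x - w)) ^ β ≤
      ‖block A x w‖ * (1 + latticeNorm (x - w)) ^ β + if w = x then ‖c‖ else 0 := by
    intro w
    have h0 : 0 ≤ latticeNorm (x - w) := latticeNorm_nonneg _
    have h1 : ‖block (A - c • 1) x w‖ ≤ ‖block A x w‖ + ‖c‖ * if w = x then 1 else 0 := by
      rw [block_sub, block_smul]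
      refine (norm_sub_le _ _).trans ?_
      rw [norm_smul]
      gcongr
      exact norm_block_one_le x w
    refine (mul_le_mul_of_nonneg_right h1 (by positivity)).trans_eq ?_
    split_ifs with h
    · subst h; rw [sub_self, latticeNorm_zero]; simp
    · simp
  have hs2 : HasSum (fun w => if w = x then ‖c‖ else 0) ‖c‖ := hasSum_ite_eq x ‖c‖
  have hs3 := (hW x).1.hasSum.add hs2
  have hs := Summable.of_nonneg_of_le (fun w => mul_nonneg (norm_nonneg _)
    (pow_nonneg (by linarith [latticeNorm_nonneg (x - w)]) β)) hle hs3.summable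
  refine ⟨hs, (hs.tsum_le_tsum hle hs3.summable).trans ?_⟩
  rw [hs3.tsum_eq]
  gcongr
  exact (hW x).2

/-- The bound on the rows of `A` in the weight `(1 + θ ‖x‖)^γ` can be chosen independent of `γ` if
`θ` may depend on `γ`. -/
lemma HasRowMoments.exists_uniform_bound {A : BulkSpace d N →L[ℂ] BulkSpace d N}
    (hA : HasRowMoments A) : ∃ B : ℝ, 0 < B ∧ ∀ γ : ℕ, ∃ θ : ℝ, 0 < θ ∧ θ ≤ 1 ∧ ∀ x,
      Summable (fun w => ‖block A x w‖ * (1 + θ * latticeNorm (x - w)) ^ γ) ∧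
        ∑' w, ‖block A x w‖ * (1 + θ * latticeNorm (x - w)) ^ γ ≤ B := by
  obtain ⟨W₀, hW₀⟩ := hA 0
  simp only [pow_zero, mul_one] at hW₀
  have hW0 : 0 ≤ W₀ := (tsum_nonneg fun w => norm_nonneg _).trans (hW₀ 0).2
  refine ⟨W₀ + 1, by linarith, fun γ => ?_⟩
  obtain ⟨W, hW⟩ := hA γ
  have hWn : 0 ≤ W := (tsum_nonneg fun w => mul_nonneg (norm_nonneg _)
    (pow_nonneg (by linarith [latticeNorm_nonneg (0 - w)]) γ)).trans (hW 0).2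
  -- By convexity, (1 + θℓ)^γ ≤ 1 + θ(1 + ℓ)^γ for 0 ≤ θ ≤ 1. The weight therefore adds at most θW ≤
  -- 1 to the unweighted row sum, whatever γ is.
  set θ : ℝ := 1 / (W + 1) with hθ
  have hθ0 : 0 < θ := by positivity
  have hθ1 : θ ≤ 1 := by rw [hθ, div_le_one (by positivity)]; linarith
  refine ⟨θ, hθ0, hθ1, fun x => ?_⟩
  have hle : ∀ w, ‖block A x w‖ * (1 + θ * latticeNorm (x - w)) ^ γ ≤
      ‖block A x w‖ + θ * (‖block A x w‖ * (1 + latticeNorm (x - w)) ^ γ) := by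
    intro w
    have h0 : 0 ≤ latticeNorm (x - w) := latticeNorm_nonneg _
    have hcv := (convexOn_pow (𝕜 := ℝ) γ).2 (Set.mem_Ici.2 zero_le_one)
      (Set.mem_Ici.2 (by linarith : 0 ≤ 1 + latticeNorm (x - w)))
      (by linarith : 0 ≤ 1 - θ) hθ0.le (by ring)
    simp only [smul_eq_mul, one_pow, mul_one] at hcv
    have h1 : (1 + θ * latticeNorm (x - w)) ^ γ ≤ 1 + θ * (1 + latticeNorm (x - w)) ^ γ := by
      calc _ = (1 - θ + θ * (1 + latticeNorm (x - w))) ^ γ := by ring_nf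
        _ ≤ _ := hcv
        _ ≤ _ := by linarith
    calc _ ≤ ‖block A x w‖ * (1 + θ * (1 + latticeNorm (x - w)) ^ γ) := by gcongr
      _ = _ := by ring
  have hs3 := (hW₀ x).1.hasSum.add ((hW x).1.hasSum.mul_left θ)
  have hs := Summable.of_nonneg_of_le (fun w => mul_nonneg (norm_nonneg _)
    (pow_nonneg (by nlinarith [latticeNorm_nonneg (x - w)]) γ)) hle hs3.summable
  refine ⟨hs, (hs.tsum_le_tsum hle hs3.summable).trans ?_⟩
  rw [hs3.tsum_eq]
  refine add_le_add (hW₀ x).2 ((mul_le_mul_of_nonneg_left (hW x).2 hθ0.le).trans ?_)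
  rw [hθ, div_mul_eq_mul_div, one_mul, div_le_one (by positivity)]
  linarith

/-- Each factor A costs one weighted row sum. Submultiplicativity moves the decay from w - y to x -
y at the price of α powers of the weight at x - w, and the growth from w to x at the price of ν
more; hence the order α + ν. -/
lemma norm_block_pow_mul_le {A T : BulkSpace d N →L[ℂ] BulkSpace d N} {α ν : ℕ} {θ B K : ℝ}
    (hθ : 0 < θ)
    (hA : ∀ x, Summable (fun w => ‖block A x w‖ * (1 + θ * latticeNorm (x - w)) ^ (α + ν)) ∧
        ∑' w, ‖block A x w‖ * (1 + θ * latticeNorm (x - w)) ^ (α + ν) ≤ B) (hB : 0 ≤ B)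
    (hK : 0 ≤ K)
    (hT : ∀ x y, ‖block T x y‖ ≤
      K * ((1 + θ * latticeNorm (x - y)) ^ α)⁻¹ * (1 + θ * latticeNorm x) ^ ν) (n : ℕ)
    (x y : Fin d → ℤ) :
    ‖block (A ^ n * T) x y‖ ≤
      K * B ^ n * ((1 + θ * latticeNorm (x - y)) ^ α)⁻¹ * (1 + θ * latticeNorm x) ^ ν := by
  have hpos : ∀ u : Fin d → ℤ, 0 < 1 + θ * latticeNorm u := fun u => by
    have := latticeNorm_nonneg u; positivity
  induction n generalizing x with
  | zero => simpa using hT x y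
  | succ n ih =>
    have hle : ∀ w, ‖block A x w‖ * (K * B ^ n * ((1 + θ * latticeNorm (w - y)) ^ α)⁻¹ *
        (1 + θ * latticeNorm w) ^ ν) ≤
        (K * B ^ n * ((1 + θ * latticeNorm (x - y)) ^ α)⁻¹ * (1 + θ * latticeNorm x) ^ ν) *
        (‖block A x w‖ * (1 + θ * latticeNorm (x - w)) ^ (α + ν)) := by
      intro w
      have h1 := one_add_latticeNorm_le hθ.le x y w
      have h2 := one_add_latticeNorm_le hθ.le w 0 x
      simp only [sub_zero] at h2
      rw [latticeNorm_sub_comm w x] at h2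
      have p1 := hpos (x - w)
      have p2 := hpos (w - y)
      have p3 := hpos (x - y)
      have p4 := hpos w
      have p5 := hpos x
      generalize 1 + θ * latticeNorm (x - w) = a at *
      generalize 1 + θ * latticeNorm (w - y) = b at *
      generalize 1 + θ * latticeNorm (x - y) = c at *
      generalize 1 + θ * latticeNorm w = e at *
      generalize 1 + θ * latticeNorm x = f at *
      have h3 : (b ^ α)⁻¹ ≤ (c ^ α)⁻¹ * a ^ α := by
        rw [inv_mul_eq_div, le_div_iff₀ (by positivity), inv_mul_le_iff₀ (by positivity),
          ← mul_pow]
        rw [mul_comm b a]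
        gcongr
      calc ‖block A x w‖ * (K * B ^ n * (b ^ α)⁻¹ * e ^ ν)
          ≤ ‖block A x w‖ * (K * B ^ n * ((c ^ α)⁻¹ * a ^ α) * (a * f) ^ ν) := by gcongr
        _ = _ := by rw [mul_pow, pow_add]; ring
    have hs3 := (hA x).1.mul_left
      (K * B ^ n * ((1 + θ * latticeNorm (x - y)) ^ α)⁻¹ * (1 + θ * latticeNorm x) ^ ν)
    have hs := Summable.of_nonneg_of_le (fun w => mul_nonneg (norm_nonneg _)
      ((norm_nonneg _).trans (ih w))) hle hs3
    rw [pow_succ', mul_assoc]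
    refine (norm_block_mul_le A (A ^ n * T) x y ih hs).trans ?_
    refine (hs.tsum_le_tsum hle hs3).trans ?_
    rw [tsum_mul_left]
    have p3 := hpos (x - y)
    have p5 := hpos x
    calc _ ≤ K * B ^ n * ((1 + θ * latticeNorm (x - y)) ^ α)⁻¹ * (1 + θ * latticeNorm x) ^ ν * B := by
          gcongr
          exact (hA x).2
      _ = _ := by ring

end Blocks

/-! ### Resolvents away from the spectrum, by interpolation. -/

section GappedResolvent

variable {d N : ℕ}

/-- Weak locality of one operator. -/
def IsWeaklyLocal (A : BulkSpace d N →L[ℂ] BulkSpace d N) : Prop :=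
  UniformlyWeaklyLocal fun _ : Unit => A

lemma UniformlyWeaklyLocal.add {ι : Type*} {A B : ι → (BulkSpace d N →L[ℂ] BulkSpace d N)}
    (hA : UniformlyWeaklyLocal A) (hB : UniformlyWeaklyLocal B) :
    UniformlyWeaklyLocal fun i => A i + B i := by
  obtain ⟨ν₁, μ₁, h₁⟩ := hA
  obtain ⟨ν₂, μ₂, h₂⟩ := hB
  refine ⟨max ν₁ ν₂, max μ₁ μ₂, fun μ hμ => ?_⟩
  obtain ⟨C₁, hC₁⟩ := h₁ μ (le_trans (le_max_left _ _) hμ)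
  obtain ⟨C₂, hC₂⟩ := h₂ μ (le_trans (le_max_right _ _) hμ)
  refine ⟨|C₁| + |C₂|, fun i x y => ?_⟩
  have hx : 1 ≤ 1 + latticeNorm x := by linarith [latticeNorm_nonneg x]
  have hxy : 0 ≤ 1 + latticeNorm (x - y) := by linarith [latticeNorm_nonneg (x - y)]
  rw [block_add, add_mul, add_mul]
  refine (norm_add_le _ _).trans (add_le_add ((hC₁ i x y).trans ?_) ((hC₂ i x y).trans ?_))
  · gcongr
    · exact le_abs_self _
    · exact le_max_left _ _
  · gcongr
    · exact le_abs_self _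
    · exact le_max_right _ _

lemma UniformlyWeaklyLocal.comp {ι κ : Type*} {A : ι → (BulkSpace d N →L[ℂ] BulkSpace d N)}
    (hA : UniformlyWeaklyLocal A) (g : κ → ι) : UniformlyWeaklyLocal fun k => A (g k) := by
  obtain ⟨ν, μ₀, h⟩ := hA
  refine ⟨ν, μ₀, fun μ hμ => ?_⟩
  obtain ⟨C, hC⟩ := h μ hμ
  exact ⟨C, fun i => hC (g i)⟩

/-- If the powers of `A`, multiplied by the weakly local `T`, grow at most at the rate `r < s`, then
`s⁻ⁿ Aⁿ T` is weakly local uniformly in `n`. -/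
lemma exists_norm_block_pow_mul_le {A T : BulkSpace d N →L[ℂ] BulkSpace d N}
    (hA : HasRowMoments A) (hT : IsWeaklyLocal T) {K₀ r s : ℝ} (hr : 0 ≤ r) (hrs : r < s)
    (hAT : ∀ n : ℕ, ‖A ^ n * T‖ ≤ K₀ * r ^ n) :
    ∃ ν μ₀ : ℕ, ∀ μ, μ₀ ≤ μ → ∃ C : ℝ, 0 ≤ C ∧ ∀ (n : ℕ) (x y : Fin d → ℤ),
      ‖block (A ^ n * T) x y‖ ≤
        C * s ^ n * (((1 + latticeNorm (x - y)) ^ μ)⁻¹ * (1 + latticeNorm x) ^ ν) := by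
  have hs : 0 < s := hr.trans_lt hrs
  have hK₀ : 0 ≤ K₀ := by simpa using (norm_nonneg _).trans (hAT 0)
  obtain ⟨ν, μ₀, hT⟩ := hT
  obtain ⟨B, hB, hAB⟩ := hA.exists_uniform_bound
  -- The interpolation exponent: j parts of the norm rate r and one part of the locality rate B give
  -- a geometric mean of at most s. As B is independent of the decay order, j is fixed before μ.
  obtain ⟨j, hj⟩ : ∃ j : ℕ, r ^ j * B ≤ s ^ (j + 1) := by
    obtain ⟨j, hj⟩ := exists_pow_lt_of_lt_one (div_pos hs hB) ((div_lt_one hs).2 hrs)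
    refine ⟨j, ?_⟩
    rw [div_pow, div_lt_div_iff₀ (by positivity) hB] at hj
    rw [pow_succ']
    exact hj.le
  refine ⟨ν, μ₀, fun μ hμ => ?_⟩
  -- A (j + 1)-th root will be taken, so the decay asked of T is j + 1 times the target.
  obtain ⟨C, hC⟩ := hT ((j + 1) * μ) (hμ.trans (Nat.le_mul_of_pos_left _ j.succ_pos))
  obtain ⟨θ, hθ0, hθ1, hθ⟩ := hAB ((j + 1) * μ + ν)
  set α := (j + 1) * μ with hα
  have hpos : ∀ u : Fin d → ℤ, 0 < 1 + θ * latticeNorm u := fun u => by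
    have := latticeNorm_nonneg u; positivity
  have hone : ∀ u : Fin d → ℤ, 1 ≤ 1 + latticeNorm u := fun u => by
    linarith [latticeNorm_nonneg u]
  have hle2 : ∀ u : Fin d → ℤ, θ * (1 + latticeNorm u) ≤ 1 + θ * latticeNorm u := fun u => by
    linarith
  set K : ℝ := |C| * (θ ^ ν)⁻¹ with hK
  have hT' : ∀ x y, ‖block T x y‖ ≤
      K * ((1 + θ * latticeNorm (x - y)) ^ α)⁻¹ * (1 + θ * latticeNorm x) ^ ν := by
    intro x y
    have h1 := hC () x y
    rw [zpow_neg, zpow_natCast] at h1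
    have p1 := hpos (x - y)
    have p2 := hpos x
    have p3 := hone x
    have h4 : (1 + latticeNorm x) ^ ν ≤ (θ ^ ν)⁻¹ * (1 + θ * latticeNorm x) ^ ν := by
      rw [inv_mul_eq_div, le_div_iff₀ (by positivity), mul_comm, ← mul_pow]
      gcongr
      exact hle2 x
    calc ‖block T x y‖ ≤ |C| * ((1 + latticeNorm (x - y)) ^ α)⁻¹ * (1 + latticeNorm x) ^ ν := by
          refine h1.trans ?_
          have := hone (x - y)
          gcongr
          exact le_abs_self _
      _ ≤ |C| * ((1 + θ * latticeNorm (x - y)) ^ α)⁻¹ *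
          ((θ ^ ν)⁻¹ * (1 + θ * latticeNorm x) ^ ν) := by
          gcongr
          exact mul_le_of_le_one_left (latticeNorm_nonneg _) hθ1
      _ = _ := by rw [hK]; ring
  have hkey := fun n => norm_block_pow_mul_le hθ0 hθ hB.le (by positivity : 0 ≤ K) hT' n
  set D : ℝ := K₀ ^ j * (K * (θ ^ α)⁻¹) with hD
  have hD0 : 0 ≤ D := by positivity
  refine ⟨max 1 D, by positivity, fun n x y => ?_⟩
  have hZ : 1 ≤ (1 + latticeNorm x) ^ ν := one_le_pow₀ (hone x)
  have hX := hone (x - y)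
  have hXα : ((1 + θ * latticeNorm (x - y)) ^ α)⁻¹ ≤
      (θ ^ α)⁻¹ * (((1 + latticeNorm (x - y)) ^ μ)⁻¹) ^ (j + 1) := by
    rw [inv_pow, ← pow_mul, mul_comm μ, ← hα, ← mul_inv, ← mul_pow]
    gcongr
    exact hle2 _
  -- The norm bound is used for j factors of the (j + 1)-th power and the decaying bound for one.
  -- The growth factor is enlarged to a full (j + 1)-th power so that the root returns the same ν
  -- for every μ.
  refine le_of_pow_le_pow_left₀ (n := j + 1) (by omega) (by positivity) ?_
  have h1 : ‖block (A ^ n * T) x y‖ ≤ K₀ * r ^ n := (norm_block_le _ _ _).trans (hAT n)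
  have h2 : ‖block (A ^ n * T) x y‖ ≤ K * B ^ n *
      ((θ ^ α)⁻¹ * (((1 + latticeNorm (x - y)) ^ μ)⁻¹) ^ (j + 1)) *
        ((1 + latticeNorm x) ^ ν) ^ (j + 1) := by
    refine (hkey n x y).trans ?_
    have p1 := hpos (x - y)
    have p2 := hpos x
    gcongr
    refine le_trans ?_ (le_self_pow₀ hZ (Nat.succ_ne_zero j))
    gcongr
    exact mul_le_of_le_one_left (latticeNorm_nonneg _) hθ1
  calc ‖block (A ^ n * T) x y‖ ^ (j + 1)
      = ‖block (A ^ n * T) x y‖ ^ j * ‖block (A ^ n * T) x y‖ := pow_succ _ _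
    _ ≤ (K₀ * r ^ n) ^ j * (K * B ^ n *
      ((θ ^ α)⁻¹ * (((1 + latticeNorm (x - y)) ^ μ)⁻¹) ^ (j + 1)) *
        ((1 + latticeNorm x) ^ ν) ^ (j + 1)) := by gcongr
    _ = D * (r ^ j * B) ^ n *
        (((1 + latticeNorm (x - y)) ^ μ)⁻¹ * (1 + latticeNorm x) ^ ν) ^ (j + 1) := by
        rw [hD]; ring
    _ ≤ max 1 D ^ (j + 1) * (s ^ (j + 1)) ^ n *
        (((1 + latticeNorm (x - y)) ^ μ)⁻¹ * (1 + latticeNorm x) ^ ν) ^ (j + 1) := by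
        gcongr
        exact (le_max_right 1 D).trans (le_self_pow₀ (le_max_left _ _) (Nat.succ_ne_zero j))
    _ = _ := by ring

/-- Expansion of the resolvent at `z` in powers of `H - c`. -/
lemma inverse_sub_mul_eq {𝓐 : Type*} [Ring 𝓐] [Algebra ℂ 𝓐] (H T : 𝓐) {c z : ℂ} (hzc : z - c ≠ 0)
    (hu : IsUnit (H - z • 1)) (M : ℕ) :
    Ring.inverse (H - z • 1) * T =
      ((z - c) ^ M)⁻¹ • (Ring.inverse (H - z • 1) * ((H - c • 1) ^ M * T)) -
        ∑ n ∈ Finset.range M, ((z - c) ^ (n + 1))⁻¹ • ((H - c • 1) ^ n * T) := by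
  induction M with
  | zero => simp
  | succ M ih =>
    have h1 : Ring.inverse (H - z • 1) * ((H - c • 1) ^ (M + 1) * T) =
        (H - c • 1) ^ M * T +
          (z - c) • (Ring.inverse (H - z • 1) * ((H - c • 1) ^ M * T)) := by
      have : (H - c • 1 : 𝓐) = (H - z • 1) + (z - c) • 1 := by rw [sub_smul]; abel
      rw [pow_succ', mul_assoc]
      nth_rewrite 1 [this]
      rw [add_mul, mul_add, ← mul_assoc, Ring.inverse_mul_cancel _ hu, one_mul, smul_mul_assoc,
        one_mul, mul_smul_comm]
    rw [ih, Finset.sum_range_succ, h1, smul_add, smul_smul]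
    have : ((z - c) ^ (M + 1))⁻¹ * (z - c) = ((z - c) ^ M)⁻¹ := by
      rw [pow_succ]; field_simp
    rw [this]
    abel

/-- The resolvent is weakly local on the range of a weakly local operator away from which the
spectral parameter is separated in the sense of a power expansion about `c`. -/
theorem uniformlyWeaklyLocal_inverse_mul {H T : BulkSpace d N →L[ℂ] BulkSpace d N}
    (hH : IsLocal H) (hT : IsWeaklyLocal T) {c : ℂ} {K₀ r s : ℝ} (hr : 0 ≤ r) (hrs : r < s)
    (hHT : ∀ n : ℕ, ‖(H - c • 1) ^ n * T‖ ≤ K₀ * r ^ n) {ι : Type*} (z : ι → ℂ)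
    (hz : ∀ i, s ≤ ‖z i - c‖) (hu : ∀ i, IsUnit (H - z i • 1)) :
    UniformlyWeaklyLocal fun i => Ring.inverse (H - z i • 1) * T := by
  -- The intermediate rate q leaves room twice: q > r for the interpolation and q < s for the
  -- geometric series.
  obtain ⟨q, hrq, hqs⟩ := exists_between hrs
  have hq : 0 < q := hr.trans_lt hrq
  have hs : 0 < s := hq.trans hqs
  obtain ⟨ν, μ₀, h⟩ := exists_norm_block_pow_mul_le (hH.hasRowMoments.sub_smul_one c) hT hr hrq hHT
  refine ⟨ν, μ₀, fun μ hμ => ?_⟩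
  obtain ⟨C, hC0, hC⟩ := h μ hμ
  refine ⟨C * (s⁻¹ * (1 - q / s)⁻¹), fun i x y => ?_⟩
  have hX : 0 ≤ latticeNorm (x - y) := latticeNorm_nonneg _
  have hX' : 0 ≤ latticeNorm x := latticeNorm_nonneg _
  rw [zpow_neg, zpow_natCast]
  set W := ((1 + latticeNorm (x - y)) ^ μ)⁻¹ * (1 + latticeNorm x) ^ ν with hW
  have hW0 : 0 ≤ W := by positivity
  have hne : z i - c ≠ 0 := norm_pos_iff.1 (hs.trans_le (hz i))
  have hqs' : q / s < 1 := (div_lt_one hs).2 hqs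
  -- The remainder carries the resolvent norm, which is not uniform in i. It disappears as M → ∞
  -- with i fixed, while the sum is bounded uniformly in i and M.
  have hbound : ∀ M : ℕ, ‖block (Ring.inverse (H - z i • 1) * T) x y‖ ≤
      ‖Ring.inverse (H - z i • 1)‖ * K₀ * (r / s) ^ M + C * (s⁻¹ * (1 - q / s)⁻¹) * W := by
    intro M
    rw [inverse_sub_mul_eq H T hne (hu i) M, block_sub, block_sum]
    refine (norm_sub_le _ _).trans (add_le_add ?_ ?_)
    · rw [block_smul, norm_smul, norm_inv, norm_pow]
      calc (‖z i - c‖ ^ M)⁻¹ * ‖block (Ring.inverse (H - z i • 1) * ((H - c • 1) ^ M * T)) x y‖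
          ≤ (s ^ M)⁻¹ * (‖Ring.inverse (H - z i • 1)‖ * (K₀ * r ^ M)) := by
            gcongr
            · exact hz i
            · exact (norm_block_le _ _ _).trans ((norm_mul_le _ _).trans (by gcongr; exact hHT M))
        _ = _ := by rw [div_pow]; ring
    · calc ‖∑ n ∈ Finset.range M, block (((z i - c) ^ (n + 1))⁻¹ • ((H - c • 1) ^ n * T)) x y‖
          ≤ ∑ n ∈ Finset.range M, C * W * s⁻¹ * (q / s) ^ n := by
            refine norm_sum_le_of_le _ fun n _ => ?_
            rw [block_smul, norm_smul, norm_inv, norm_pow]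
            calc (‖z i - c‖ ^ (n + 1))⁻¹ * ‖block ((H - c • 1) ^ n * T) x y‖
                ≤ (s ^ (n + 1))⁻¹ * (C * q ^ n * W) := by
                  gcongr
                  · exact hz i
                  · exact hC n x y
              _ = _ := by rw [div_pow, pow_succ, mul_inv]; ring
        _ = C * W * s⁻¹ * ∑ n ∈ Finset.range M, (q / s) ^ n := by rw [Finset.mul_sum]
        _ ≤ C * W * s⁻¹ * (1 - q / s)⁻¹ := by
            gcongr
            rw [← tsum_geometric_of_lt_one (by positivity) hqs']
            exact (summable_geometric_of_lt_one (by positivity) hqs').sum_le_tsum _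
              fun _ _ => by positivity
        _ = _ := by ring
  have hlim : Filter.Tendsto (fun M : ℕ => ‖Ring.inverse (H - z i • 1)‖ * K₀ * (r / s) ^ M +
      C * (s⁻¹ * (1 - q / s)⁻¹) * W) Filter.atTop
      (nhds (‖Ring.inverse (H - z i • 1)‖ * K₀ * 0 + C * (s⁻¹ * (1 - q / s)⁻¹) * W)) :=
    ((tendsto_pow_atTop_nhds_zero_of_lt_one (by positivity)
      ((div_lt_one hs).2 hrs)).const_mul _).add_const _
  have := ge_of_tendsto' hlim hbound
  rw [mul_zero, zero_add, hW, ← mul_assoc] at this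
  exact this

end GappedResolvent

/-! ### Jordan decomposition of a difference of measures. -/

section SignedDecomposition

/-- On each half of a Hahn decomposition the difference has one sign, so the mass of each part is
the absolute difference on a single subset of D, to which `h` applies. Positive parts are needed
because the maximal estimate concerns positive measures. -/
lemma exists_measure_sub_eq {m₁ m₂ : Measure ℝ} [IsFiniteMeasure m₁] [IsFiniteMeasure m₂]
    {D : Set ℝ} (hD : MeasurableSet D) {b : ℝ}
    (h : ∀ t, MeasurableSet t → t ⊆ D → |m₁.real t - m₂.real t| ≤ b) :
    ∃ p q : Measure ℝ, IsFiniteMeasure p ∧ IsFiniteMeasure q ∧ p Set.univ ≤ ENNReal.ofReal b ∧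
      q Set.univ ≤ ENNReal.ofReal b ∧ ∀ g : ℝ → ℂ, IsBoundedBorel g →
        ∫ t in D, g t ∂m₁ - ∫ t in D, g t ∂m₂ = ∫ t, g t ∂p - ∫ t, g t ∂q := by
  obtain ⟨s, hs, h1, h2⟩ := hahn_decomposition m₁ m₂
  have aux : ∀ (m m' : Measure ℝ) [IsFiniteMeasure m] [IsFiniteMeasure m'] (u : Set ℝ),
      MeasurableSet u → u ⊆ D → (∀ t, MeasurableSet t → t ⊆ u → m' t ≤ m t) →
      |m.real u - m'.real u| ≤ b →
      ∃ p : Measure ℝ, IsFiniteMeasure p ∧ p Set.univ ≤ ENNReal.ofReal b ∧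
        ∀ g : ℝ → ℂ, IsBoundedBorel g → ∫ t in u, g t ∂m - ∫ t in u, g t ∂m' = ∫ t, g t ∂p := by
    intro m m' _ _ u hu huD hle hb
    have hle' : m'.restrict u ≤ m.restrict u := by
      refine Measure.le_iff.2 fun t ht => ?_
      rw [Measure.restrict_apply ht, Measure.restrict_apply ht]
      exact hle _ (ht.inter hu) Set.inter_subset_right
    have hadd := Measure.sub_add_cancel_of_le hle'
    refine ⟨m.restrict u - m'.restrict u, inferInstance, ?_, fun g hg => ?_⟩
    · have h3 := measureReal_add_apply (μ₁ := m.restrict u - m'.restrict u)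
        (μ₂ := m'.restrict u) (s := Set.univ)
      rw [hadd, measureReal_restrict_apply_univ, measureReal_restrict_apply_univ] at h3
      rw [← ofReal_measureReal]
      refine ENNReal.ofReal_le_ofReal ?_
      linarith [le_abs_self (m.real u - m'.real u)]
    · conv_lhs => rw [← hadd]
      rw [integral_add_measure (hg.integrable _) (hg.integrable _)]
      ring
  obtain ⟨p, hp, hpb, hpg⟩ := aux m₁ m₂ (D ∩ s) (hD.inter hs) Set.inter_subset_left
    (fun t ht htu => h1 t ht (htu.trans Set.inter_subset_right))
    (h _ (hD.inter hs) Set.inter_subset_left)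
  obtain ⟨q, hq, hqb, hqg⟩ := aux m₂ m₁ (D \ s) (hD.diff hs) Set.sdiff_subset
    (fun t ht htu => h2 t ht (htu.trans fun x hx => hx.2))
    (by rw [abs_sub_comm]; exact h _ (hD.diff hs) Set.sdiff_subset)
  refine ⟨p, q, hp, hq, hpb, hqb, fun g hg => ?_⟩
  rw [← hpg g hg, ← hqg g hg, ← integral_inter_add_sdiff hs (hg.integrable m₁).integrableOn,
    ← integral_inter_add_sdiff hs (hg.integrable m₂).integrableOn]
  ring

end SignedDecomposition

/-! ### Resolvent matrix elements as Cauchy transforms. -/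

section MatrixElements

variable {E : Type*} [NormedAddCommGroup E] [InnerProductSpace ℂ E] [CompleteSpace E]
  {H : E →L[ℂ] E}

lemma borelQuad_indicator {t : Set ℝ} (ht : MeasurableSet t) (ψ : E) :
    borelQuad H (t.indicator fun _ => 1) ψ = ((spectralMeasureAt H ψ).real t : ℂ) := by
  rw [borelQuad, integral_indicator ht]
  simp

lemma integral_mul_indicator_one (m : Measure ℝ) {D : Set ℝ} (hD : MeasurableSet D) (g : ℝ → ℂ) :
    ∫ t, g t * D.indicator (fun _ => 1) t ∂m = ∫ t in D, g t ∂m := by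
  rw [← integral_indicator hD]
  congr 1
  ext t
  by_cases h : t ∈ D <;> simp [h]

/-- A matrix element of the resolvent on a spectral subspace is a combination of Cauchy transforms
of positive measures, whose masses are controlled by the variation of the spectral measure. -/
theorem exists_norm_inner_inverse_le (hH : IsSelfAdjoint H) {D : Set ℝ} (hD : MeasurableSet D)
    {φ ψ : E} {b : ℝ}
    (hb : ∀ t, MeasurableSet t → t ⊆ D →
      ‖inner ℂ φ (borelCalculus H (t.indicator fun _ => 1) ψ)‖ ≤ b) :
    ∃ p : Fin 4 → Measure ℝ, (∀ i, IsFiniteMeasure (p i)) ∧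
      (∀ i, p i Set.univ ≤ ENNReal.ofReal (4 * b)) ∧ ∀ z : ℂ, z.im ≠ 0 →
        ‖inner ℂ φ ((Ring.inverse (H - z • 1) * borelCalculus H (D.indicator fun _ => 1)) ψ)‖ ≤
          ∑ i, ‖resolventTransform (p i) z‖ := by
  -- Spectral measures are real, so the two differences in the polarization formula are four times
  -- the real and imaginary parts of the matrix element.
  have hform : ∀ t, MeasurableSet t → t ⊆ D →
      |(spectralMeasureAt H (ψ + φ)).real t - (spectralMeasureAt H (ψ - φ)).real t| ≤ 4 * b ∧
      |(spectralMeasureAt H (ψ + Complex.I • φ)).real t -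
        (spectralMeasureAt H (ψ - Complex.I • φ)).real t| ≤ 4 * b := by
    intro t ht htD
    have h1 := hb t ht htD
    rw [inner_borelCalculus_eq_borelForm H (isBoundedBorel_indicator ht)] at h1
    unfold borelForm at h1
    simp only [borelQuad_indicator ht] at h1
    have h2 := (Complex.abs_re_le_norm _).trans h1
    have h3 := (Complex.abs_im_le_norm _).trans h1
    simp at h2 h3
    constructor
    · linarith
    · linarith
  obtain ⟨p₁, q₁, hp₁, hq₁, hpb₁, hqb₁, h₁⟩ := exists_measure_sub_eq hD
    fun t ht htD => (hform t ht htD).1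
  obtain ⟨p₂, q₂, hp₂, hq₂, hpb₂, hqb₂, h₂⟩ := exists_measure_sub_eq hD
    fun t ht htD => (hform t ht htD).2
  have hclip : Measurable (clip ‖H‖) := (continuous_clip _).measurable
  have hmap : ∀ (p : Measure ℝ) (z : ℂ), resolventTransform (p.map (clip ‖H‖)) z =
      ∫ t, ((clip ‖H‖ t : ℂ) - z)⁻¹ ∂p := by
    intro p z
    rw [resolventTransform_eq_integral_inv, integral_map hclip.aemeasurable]
    exact Measurable.aestronglyMeasurable (by fun_prop)
  -- The calculus integrates (clip t - z)⁻¹; pushing the measures forward along `clip ‖H‖` makes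
  -- these integrals genuine Cauchy transforms.
  refine ⟨![p₁.map (clip ‖H‖), q₁.map (clip ‖H‖), p₂.map (clip ‖H‖), q₂.map (clip ‖H‖)], ?_, ?_, ?_⟩
  · intro i
    fin_cases i
    · exact Measure.isFiniteMeasure_map p₁ _
    · exact Measure.isFiniteMeasure_map q₁ _
    · exact Measure.isFiniteMeasure_map p₂ _
    · exact Measure.isFiniteMeasure_map q₂ _
  · intro i
    fin_cases i
    · exact (Measure.map_apply hclip MeasurableSet.univ).trans_le hpb₁
    · exact (Measure.map_apply hclip MeasurableSet.univ).trans_le hqb₁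
    · exact (Measure.map_apply hclip MeasurableSet.univ).trans_le hpb₂
    · exact (Measure.map_apply hclip MeasurableSet.univ).trans_le hqb₂
  · intro z hz
    have hk := isBoundedBorel_inv_clip_sub ‖H‖ hz
    rw [inverse_mul_borelCalculus hH le_rfl hz (isBoundedBorel_indicator hD),
      inner_borelCalculus_eq_borelForm H (hk.mul (isBoundedBorel_indicator hD))]
    unfold borelForm borelQuad
    simp only [integral_mul_indicator_one _ hD]
    rw [h₁ _ hk, add_sub_assoc, ← mul_sub, h₂ _ hk]
    simp only [← hmap]
    simp only [Fin.sum_univ_four, Matrix.cons_val]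
    generalize resolventTransform (p₁.map (clip ‖H‖)) z = a₁
    generalize resolventTransform (q₁.map (clip ‖H‖)) z = a₂
    generalize resolventTransform (p₂.map (clip ‖H‖)) z = a₃
    generalize resolventTransform (q₂.map (clip ‖H‖)) z = a₄
    have e1 := norm_add_le (a₁ - a₂) (Complex.I * (a₃ - a₄))
    have e2 := norm_sub_le a₁ a₂
    have e3 := norm_sub_le a₃ a₄
    rw [norm_mul, Complex.norm_I, one_mul] at e1
    rw [norm_mul]
    norm_num
    linarith [norm_nonneg (a₁ - a₂ + Complex.I * (a₃ - a₄))]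

end MatrixElements

/-! ### Weak locality of the resolvent on spectral subspaces. -/

section Lattice

variable {d N : ℕ}

lemma inner_single_apply_single (A : BulkSpace d N →L[ℂ] BulkSpace d N) (x y : Fin d → ℤ)
    (v w : EuclideanSpace ℂ (Fin N)) :
    inner ℂ (lp.single 2 x v : BulkSpace d N) (A (lp.single 2 y w)) =
      inner ℂ v (block A x y w) := by
  rw [lp.inner_single_left, block_apply]

lemma norm_le_sum_norm_inner (T : EuclideanSpace ℂ (Fin N) →L[ℂ] EuclideanSpace ℂ (Fin N)) :
    ‖T‖ ≤ ∑ j, ∑ i, ‖(inner ℂ (EuclideanSpace.basisFun (Fin N) ℂ i)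
      (T (EuclideanSpace.basisFun (Fin N) ℂ j)) : ℂ)‖ := by
  set e := EuclideanSpace.basisFun (Fin N) ℂ
  have hcol : ∀ v, ‖v‖ ≤ ∑ i, ‖(inner ℂ (e i) v : ℂ)‖ := by
    intro v
    conv_lhs => rw [← e.sum_repr' v]
    refine norm_sum_le_of_le _ fun i _ => ?_
    rw [norm_smul, e.norm_eq_one, mul_one]
  refine ContinuousLinearMap.opNorm_le_bound _ (by positivity) fun v => ?_
  conv_lhs => rw [← e.sum_repr' v]
  rw [map_sum, Finset.sum_mul]
  refine norm_sum_le_of_le _ fun j _ => ?_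
  rw [map_smul, norm_smul, mul_comm]
  gcongr
  · exact hcol _
  · exact (norm_inner_le_norm _ _).trans (by rw [e.norm_eq_one, one_mul])

/-- On the spectral subspace of a set on which the spectral measures are weakly local, almost all
resolvents are weakly local. -/
theorem ae_uniformlyWeaklyLocal_inverse_mul {H : BulkSpace d N →L[ℂ] BulkSpace d N}
    (hH : IsSelfAdjoint H) {D : Set ℝ} (hD : MeasurableSet D)
    (hW : UniformlyWeaklyLocal fun t : {t : Set ℝ // MeasurableSet t ∧ t ⊆ D} =>
      borelCalculus H (t.1.indicator fun _ => 1)) :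
    ∀ᵐ E : ℝ, UniformlyWeaklyLocal fun ε : {ε : ℝ // ε ≠ 0} =>
      Ring.inverse (H - ((E : ℂ) + Complex.I * (ε.1 : ℂ)) • 1) *
        borelCalculus H (D.indicator fun _ => 1) := by
  obtain ⟨ν, μ₀, h⟩ := hW
  -- The null set may depend on μ, since there are only countably many μ.
  suffices hμ : ∀ μ, μ₀ ≤ μ → ∀ᵐ E : ℝ, ∃ C : ℝ, ∀ (ε : {ε : ℝ // ε ≠ 0}) (x y : Fin d → ℤ),
      ‖block (Ring.inverse (H - ((E : ℂ) + Complex.I * (ε.1 : ℂ)) • 1) *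
        borelCalculus H (D.indicator fun _ => 1)) x y‖ ≤
      C * (1 + latticeNorm (x - y)) ^ (-(μ : ℤ)) * (1 + latticeNorm x) ^ (ν + 2 * d) by
    have : ∀ᵐ E : ℝ, ∀ μ, μ₀ ≤ μ → ∃ C : ℝ, ∀ (ε : {ε : ℝ // ε ≠ 0}) (x y : Fin d → ℤ),
      ‖block (Ring.inverse (H - ((E : ℂ) + Complex.I * (ε.1 : ℂ)) • 1) *
        borelCalculus H (D.indicator fun _ => 1)) x y‖ ≤
      C * (1 + latticeNorm (x - y)) ^ (-(μ : ℤ)) * (1 + latticeNorm x) ^ (ν + 2 * d) :=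
      ae_all_iff.2 fun μ => ae_all_iff.2 fun hμ' => hμ μ hμ'
    filter_upwards [this] with E hE using ⟨ν + 2 * d, μ₀, hE⟩
  intro μ hμ
  -- The extra decay 2d makes the normalised masses summable over y; the growth exponent, raised
  -- from ν to ν + 2d, makes them summable over x.
  obtain ⟨C, hC⟩ := h (μ + 2 * d) (by omega)
  set e := EuclideanSpace.basisFun (Fin N) ℂ with he
  set δ : (Fin d → ℤ) → Fin N → BulkSpace d N := fun x i => lp.single 2 x (e i) with hδ
  set X : (Fin d → ℤ) → ℝ := fun x => 1 + latticeNorm x with hX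
  have hX1 : ∀ x, 1 ≤ X x := fun x => by simp only [hX]; linarith [latticeNorm_nonneg x]
  have hX0 : ∀ x, 0 < X x := fun x => zero_lt_one.trans_le (hX1 x)
  set b : (Fin d → ℤ) → (Fin d → ℤ) → ℝ := fun x y =>
    |C| * (X (x - y) ^ (μ + 2 * d))⁻¹ * X x ^ ν with hb
  set lam : (Fin d → ℤ) → (Fin d → ℤ) → ℝ := fun x y =>
    (X (x - y) ^ μ)⁻¹ * X x ^ (ν + 2 * d) with hlam
  have hlam0 : ∀ x y, 0 < lam x y := fun x y => by
    have := hX0 x; have := hX0 (x - y); simp only [hlam]; positivity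
  have hentry : ∀ x y i j t, MeasurableSet t → t ⊆ D →
      ‖inner ℂ (δ x i) (borelCalculus H (t.indicator fun _ => 1) (δ y j))‖ ≤ b x y := by
    intro x y i j t ht htD
    rw [hδ]
    simp only
    rw [inner_single_apply_single]
    refine (norm_inner_le_norm _ _).trans ?_
    rw [e.norm_eq_one, one_mul]
    refine (ContinuousLinearMap.le_opNorm _ _).trans ?_
    rw [e.norm_eq_one, mul_one]
    refine (hC ⟨t, ht, htD⟩ x y).trans ?_
    rw [zpow_neg, zpow_natCast]
    have := hX0 x
    have := hX0 (x - y)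
    simp only [hb]
    gcongr
    exact le_abs_self C
  choose p hpf hpb hp using fun x y i j => exists_norm_inner_inverse_le hH hD (hentry x y i j)
  -- Dividing by the target weight `lam` turns a single bound K for all normalised transforms into
  -- the required estimate on every block.
  set m : (Fin d → ℤ) × (Fin d → ℤ) × Fin N × Fin N × Fin 4 → Measure ℝ := fun a =>
    ENNReal.ofReal (lam a.1 a.2.1)⁻¹ • p a.1 a.2.1 a.2.2.1 a.2.2.2.1 a.2.2.2.2 with hm
  have hmf : ∀ a, IsFiniteMeasure (m a) := fun a => by
    have := hpf a.1 a.2.1 a.2.2.1 a.2.2.2.1 a.2.2.2.2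
    exact Measure.smul_finite _ ENNReal.ofReal_ne_top
  have hmass : ∀ a, m a Set.univ ≤
      ENNReal.ofReal (4 * |C|) * (ENNReal.ofReal (X a.1 ^ (2 * d))⁻¹ *
        ENNReal.ofReal (X (a.1 - a.2.1) ^ (2 * d))⁻¹) := by
    rintro ⟨x, y, i, j, k⟩
    have := hX0 x
    have := hX0 (x - y)
    simp only [hm, Measure.smul_apply, smul_eq_mul]
    refine (mul_le_mul_right (hpb x y i j k) _).trans_eq ?_
    rw [← ENNReal.ofReal_mul (inv_nonneg.2 (hlam0 x y).le), ← ENNReal.ofReal_mul (by positivity),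
      ← ENNReal.ofReal_mul (by positivity)]
    congr 1
    simp only [hlam, hb]
    field_simp
    ring
  have hsum : ∑' a, m a Set.univ ≠ ⊤ := by
    have hs : ∑' x : Fin d → ℤ, ENNReal.ofReal (X x ^ (2 * d))⁻¹ ≠ ⊤ := by
      rw [← ENNReal.ofReal_tsum_of_nonneg (fun x => by have := hX0 x; positivity)
        summable_inv_one_add_latticeNorm]
      exact ENNReal.ofReal_ne_top
    refine ne_top_of_le_ne_top ?_ (ENNReal.tsum_le_tsum hmass)
    rw [ENNReal.tsum_mul_left]
    refine ENNReal.mul_ne_top ENNReal.ofReal_ne_top ?_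
    rw [ENNReal.tsum_prod']
    simp only [ENNReal.tsum_prod', ENNReal.tsum_mul_left]
    have hshift : ∀ x : Fin d → ℤ, ∑' y, ENNReal.ofReal (X (x - y) ^ (2 * d))⁻¹ =
        ∑' x : Fin d → ℤ, ENNReal.ofReal (X x ^ (2 * d))⁻¹ := fun x =>
      (Equiv.subLeft x).tsum_eq fun y => ENNReal.ofReal (X y ^ (2 * d))⁻¹
    simp only [tsum_fintype, Finset.sum_const, Finset.card_univ, nsmul_eq_mul,
      ENNReal.tsum_mul_left, ENNReal.tsum_mul_right, hshift]
    have hn : ∀ n : ℕ, (n : ENNReal) ≠ ⊤ := ENNReal.natCast_ne_top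
    exact ENNReal.mul_ne_top hs (ENNReal.mul_ne_top (hn _) (ENNReal.mul_ne_top (hn _)
      (ENNReal.mul_ne_top (hn _) hs)))
  filter_upwards [ae_exists_norm_resolventTransform_le m hsum] with E ⟨K, hK⟩
  refine ⟨∑ _j : Fin N, ∑ _i : Fin N, 4 * K, fun ε x y => ?_⟩
  have hz : ((E : ℂ) + Complex.I * (ε.1 : ℂ)).im ≠ 0 := by simpa using ε.2
  rw [zpow_neg, zpow_natCast, mul_assoc]
  refine (norm_le_sum_norm_inner _).trans ?_
  rw [Finset.sum_mul]
  refine Finset.sum_le_sum fun j _ => ?_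
  rw [Finset.sum_mul]
  refine Finset.sum_le_sum fun i _ => ?_
  rw [← inner_single_apply_single]
  refine (hp x y i j _ hz).trans ?_
  have hone : ∀ k, ‖resolventTransform (p x y i j k) ((E : ℂ) + Complex.I * (ε.1 : ℂ))‖ ≤
      K * lam x y := by
    intro k
    have h1 := hK (x, y, i, j, k) ε.1 ε.2
    simp only [hm, resolventTransform_eq_integral_inv, integral_smul_measure,
      ENNReal.toReal_ofReal (inv_nonneg.2 (hlam0 x y).le), norm_smul, norm_inv, Real.norm_eq_abs,
      abs_of_pos (hlam0 x y)] at h1 ⊢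
    rwa [inv_mul_le_iff₀ (hlam0 x y), mul_comm (lam x y)] at h1
  calc _ ≤ ∑ _k : Fin 4, K * lam x y := Finset.sum_le_sum fun k _ => hone k
    _ = _ := by simp [hlam, hX]; ring

/-- The resolvent on the spectral subspace of a set separated from the spectral parameters. -/
lemma uniformlyWeaklyLocal_inverse_mul_borelCalculus {H : BulkSpace d N →L[ℂ] BulkSpace d N}
    (hH : IsSelfAdjoint H) (hHl : IsLocal H) {U : Set ℝ} (hU : MeasurableSet U)
    (hW : IsWeaklyLocal (borelCalculus H (U.indicator fun _ => 1))) {L c r E : ℝ} (hL : ‖H‖ ≤ L)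
    (hr : 0 ≤ r) (hc : ∀ t ∈ U, |clip L t - c| ≤ r) (hE : r < |E - c|) :
    UniformlyWeaklyLocal fun ε : {ε : ℝ // ε ≠ 0} =>
      Ring.inverse (H - ((E : ℂ) + Complex.I * (ε.1 : ℂ)) • 1) *
        borelCalculus H (U.indicator fun _ => 1) := by
  refine uniformlyWeaklyLocal_inverse_mul hHl hW (c := c) (K₀ := 4) hr hE (fun n => ?_) _
    (fun ε => ?_) fun ε => isUnit_sub_smul_one hH (by simpa using ε.2)
  · rw [← borelCalculus_clip_sub_pow_mul hH hL _ (isBoundedBorel_indicator hU)]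
    have hL0 : 0 ≤ L := (norm_nonneg _).trans hL
    refine norm_borelCalculus_le H ((isBoundedBorel_pow (isBoundedBorel_clip_sub hL0 _) n).mul
      (isBoundedBorel_indicator hU)).1 fun t => ?_
    by_cases ht : t ∈ U
    · rw [Set.indicator_of_mem ht, mul_one, norm_pow]
      gcongr
      rw [← Complex.ofReal_sub, Complex.norm_real]
      exact hc t ht
    · rw [Set.indicator_of_notMem ht, mul_zero, norm_zero]
      positivity
  -- The centre c is real, so the distance from E + iε to c is at least |E - c|, uniformly in ε.
  · have := Complex.abs_re_le_norm ((E : ℂ) + Complex.I * (ε.1 : ℂ) - c)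
    simpa using this

/-- An indicator is constant on a half-line that its set contains or misses, so these indicators
belong to `borelUnitClass Δ`. -/
lemma IsInsulator.uniformlyWeaklyLocal_indicator {H : BulkSpace d N →L[ℂ] BulkSpace d N}
    {Δ : Set ℝ} (hH : IsInsulator H Δ) {κ : Type*} (t : κ → Set ℝ)
    (ht : ∀ k, MeasurableSet (t k))
    (hl : ∀ k, lowerBounds Δ ⊆ t k ∨ Disjoint (lowerBounds Δ) (t k))
    (hu : ∀ k, upperBounds Δ ⊆ t k ∨ Disjoint (upperBounds Δ) (t k)) :
    UniformlyWeaklyLocal fun k => borelCalculus H ((t k).indicator fun _ => 1) := by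
  have hconst : ∀ {s u : Set ℝ}, s ⊆ u ∨ Disjoint s u →
      ∃ c : ℂ, ∀ x ∈ s, u.indicator (fun _ => (1 : ℂ)) x = c := by
    rintro s u (h | h)
    · exact ⟨1, fun x hx => Set.indicator_of_mem (h hx) _⟩
    · exact ⟨0, fun x hx => Set.indicator_of_notMem (Set.disjoint_left.1 h hx) _⟩
  exact hH.weaklyLocal.comp fun k => (⟨(t k).indicator fun _ => 1,
    measurable_const.indicator (ht k), fun x => by by_cases h : x ∈ t k <;> simp [h],
    hconst (hl k), hconst (hu k)⟩ : borelUnitClass Δ)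

end Lattice

/-! ### Assembly of the three spectral pieces. -/

theorem mainTheorem7 (d N : ℕ) (Δ : Set ℝ) (hΔ : Δ.OrdConnected)
    (H : BulkSpace d N →L[ℂ] BulkSpace d N) (hH : IsInsulator H Δ) :
    ∃ S : Set ℝ, S ⊆ Δ ∧ MeasurableSet S ∧ volume (Δ \ S) = 0 ∧
      ∀ E ∈ S,
        (∀ ε ∈ Set.Icc (-1 : ℝ) 1 \ {0}, IsUnit (H - ((E : ℂ) + Complex.I * (ε : ℂ)) • 1)) ∧
        UniformlyWeaklyLocal (fun ε : ↥(Set.Icc (-1 : ℝ) 1 \ {0}) =>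
          Ring.inverse (H - ((E : ℂ) + Complex.I * ((ε : ℝ) : ℂ)) • 1)) := by
  have hsa := hH.selfAdjoint
  set Lo := lowerBounds Δ with hLo
  set Up := upperBounds Δ with hUp
  have hLom : MeasurableSet Lo := Set.OrdConnected.measurableSet
    ⟨fun _ _ _ hy _ hz _ ht => hz.2.trans (hy ht)⟩
  have hUpm : MeasurableSet Up := Set.OrdConnected.measurableSet
    ⟨fun _ hx _ _ _ hz _ ht => (hx ht).trans hz.1⟩
  -- Endpoints of Δ fall into the half-lines. Every Borel subset of D thus misses both of them,
  -- which gives the variation bounds.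
  set D := (Lo ∪ Up)ᶜ with hD
  have hDm : MeasurableSet D := (hLom.union hUpm).compl
  have hDW := hH.uniformlyWeaklyLocal_indicator
    (fun t : {t : Set ℝ // MeasurableSet t ∧ t ⊆ D} => t.1) (fun t => t.2.1)
    (fun t => Or.inr (Set.disjoint_left.2 fun x hx hxt => t.2.2 hxt (Or.inl hx)))
    (fun t => Or.inr (Set.disjoint_left.2 fun x hx hxt => t.2.2 hxt (Or.inr hx)))
  have hae := ae_uniformlyWeaklyLocal_inverse_mul hsa hDm hDW
  set G := {E : ℝ | UniformlyWeaklyLocal fun ε : {ε : ℝ // ε ≠ 0} =>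
      Ring.inverse (H - ((E : ℂ) + Complex.I * (ε.1 : ℂ)) • 1) *
        borelCalculus H (D.indicator fun _ => 1)} with hG
  have hG0 : volume Gᶜ = 0 := hae
  -- The good set G is not known to be measurable, so a measurable null hull of its complement is
  -- removed. Passing to the interior costs only the frontier of a convex set.
  refine ⟨interior Δ \ toMeasurable volume Gᶜ, Set.sdiff_subset.trans interior_subset,
    isOpen_interior.measurableSet.diff (measurableSet_toMeasurable _ _), ?_, ?_⟩
  · refine measure_mono_null (t := frontier Δ ∪ toMeasurable volume Gᶜ) ?_ ?_
    · intro x hx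
      by_cases h : x ∈ toMeasurable volume Gᶜ
      · exact Or.inr h
      · exact Or.inl ⟨subset_closure hx.1, fun hi => hx.2 ⟨hi, h⟩⟩
    · rw [measure_union_null_iff, measure_toMeasurable]
      exact ⟨hΔ.convex.addHaar_frontier volume, hG0⟩
  · rintro E ⟨hEi, hEG⟩
    have hEG' : E ∈ G := by
      by_contra h
      exact hEG (subset_toMeasurable _ _ h)
    refine ⟨fun ε hε => isUnit_sub_smul_one hsa (by simpa using hε.2), ?_⟩
    obtain ⟨r, hr, hball⟩ := Metric.isOpen_iff.1 isOpen_interior E hEi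
    have hE₁ : E + r / 2 ∈ Δ := interior_subset (hball (by
      rw [Metric.mem_ball, Real.dist_eq, add_sub_cancel_left, abs_of_pos (by positivity)]
      linarith))
    have hE₂ : E - r / 2 ∈ Δ := interior_subset (hball (by
      rw [Metric.mem_ball, Real.dist_eq, sub_sub_cancel_left, abs_neg, abs_of_pos (by positivity)]
      linarith))
    have hdisj : Disjoint Lo Up := Set.disjoint_left.2 fun x h1 h2 => by
      have := h1 hE₂
      have := h2 hE₁
      linarith
    -- L is large enough that truncation fixes E ± r/2 and does not change H.
    set L := max ‖H‖ (|E| + r) with hLdef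
    have hLH : ‖H‖ ≤ L := le_max_left _ _
    have hLE : |E| + r ≤ L := le_max_right _ _
    have hEl := neg_abs_le E
    have hEu := le_abs_self E
    have hL0 : 0 ≤ L := (norm_nonneg _).trans hLH
    have hUpW : IsWeaklyLocal (borelCalculus H (Up.indicator fun _ => 1)) :=
      hH.uniformlyWeaklyLocal_indicator (fun _ : Unit => Up) (fun _ => hUpm)
        (fun _ => Or.inr hdisj) (fun _ => Or.inl le_rfl)
    have hLoW : IsWeaklyLocal (borelCalculus H (Lo.indicator fun _ => 1)) :=
      hH.uniformlyWeaklyLocal_indicator (fun _ : Unit => Lo) (fun _ => hLom)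
        (fun _ => Or.inl le_rfl) (fun _ => Or.inr hdisj.symm)
    -- On the upper half-line the truncated variable lies in [E + r/2, L], so seen from c = L + 1 it
    -- is closer than E by at least r/2. The lower half-line is the mirror image.
    have h1 := uniformlyWeaklyLocal_inverse_mul_borelCalculus hsa hH.isLocal hUpm hUpW hLH
      (c := L + 1) (r := L + 1 - (E + r / 2)) (E := E) (by linarith)
      (fun t ht => by
        have h2 := clip_mono L (ht hE₁)
        rw [clip_eq_self (abs_le.2 ⟨by linarith, by linarith⟩)] at h2
        have h3 := abs_le.1 (abs_clip_le hL0 t)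
        rw [abs_le]
        constructor <;> linarith [h3.1, h3.2])
      (by rw [abs_sub_comm]; exact (by linarith : _ < L + 1 - E).trans_le (le_abs_self _))
    have h2 := uniformlyWeaklyLocal_inverse_mul_borelCalculus hsa hH.isLocal hLom hLoW hLH
      (c := -(L + 1)) (r := L + 1 + (E - r / 2)) (E := E) (by linarith)
      (fun t ht => by
        have h2 := clip_mono L (ht hE₂)
        rw [clip_eq_self (t := E - r / 2) (abs_le.2 ⟨by linarith, by linarith⟩)] at h2
        have h3 := abs_le.1 (abs_clip_le hL0 t)
        rw [abs_le]
        constructor <;> linarith [h3.1, h3.2])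
      ((by linarith : _ < E - -(L + 1)).trans_le (le_abs_self _))
    have hone : borelCalculus H (D.indicator fun _ => 1) + borelCalculus H (Up.indicator fun _ => 1)
        + borelCalculus H (Lo.indicator fun _ => 1) = 1 := by
      rw [← borelCalculus_one H hsa, ← borelCalculus_add H (isBoundedBorel_indicator hDm)
        (isBoundedBorel_indicator hUpm), ← borelCalculus_add H ((isBoundedBorel_indicator hDm).add
        (isBoundedBorel_indicator hUpm)) (isBoundedBorel_indicator hLom)]
      congr 1
      ext t
      by_cases ha : t ∈ Lo
      · have hb : t ∉ Up := Set.disjoint_left.1 hdisj ha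
        simp [hD, ha, hb]
      · by_cases hb : t ∈ Up <;> simp [hD, ha, hb]
    have h3 := ((hEG'.add h1).add h2).comp
      (fun ε : ↥(Set.Icc (-1 : ℝ) 1 \ {0}) => (⟨ε.1, ε.2.2⟩ : {ε : ℝ // ε ≠ 0}))
    simpa only [← mul_add, hone, mul_one] using h3
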